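/- **Setting.** Let $g:\mathbb{R}\to[0,\infty)$ be a probability density, and let $(u,v)=\int_{\mathbb{R}}u(\omega)\overline{v(\omega)}g(\omega)\,d\omega$ be the inner product of the complex Hilbert space $L^2(\mathbb{R},g(\omega)d\omega)$. Put $P_0\equiv 1$, $(\mathcal{M}u)(\omega)=\omega u(\omega)$ with its maximal domain, $\mathcal{P}u=(u,P_0)P_0$, and for $K>0$, $f_1\in\mathbb{C}$ let $$T_1=i\mathcal{M}+iKf_1\mathcal{P},\qquad \mathsf{D}(T_1)=\mathsf{D}(\mathcal{M}).$$ Let $q\in L^2(\mathbb{R},g(\omega)d\omega)$, and put $D(\lambda)=\int_{\mathbb{R}}\frac{g(\omega)}{\lambda-i\omega}d\omega$ and $F_0(\lambda)=((\lambda-T_1)^{-1}q,P_0)$ for $\operatorname{Re}\lambda>0$. **Theorem 3.12.** Let $\operatorname{Im}(f_1)\ge 0$ and let $K>0$ be fixed. Suppose that (ii) $g$ is real analytic on $\mathbb{R}$ and has a meromorphic continuation $g^*$ to the upper half plane; (iii) $q$ is (complex-valued) real analytic on $\mathbb{R}$ and has an analytic continuation $q^*$ to the upper half plane. Let $F_1$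 be the meromorphic function on $\mathbb{C}$ that equals $F_0$ on $\operatorname{Re}\lambda>0$ and is given on $\operatorname{Re}\lambda<0$ by $$F_1(\lambda)=\frac{\int_{\mathbb{R}}\frac{q(\omega)g(\omega)}{\lambda-i\omega}d\omega+2\pi q^*(-i\lambda)g^*(-i\lambda)}{1-iKf_1D(\lambda)-2\pi iKf_1g^*(-i\lambda)}.$$ Suppose that there is $\delta>0$ such that (iv) $F_1(\lambda)\to0$ as $|\lambda|\to\infty$ in the sectors $|\arg\lambda-\pi/2|\le\delta$ and $|\arg\lambda+\pi/2|\le\delta$; (v) there are constants $C,\beta>0$ and radii $r_n\to\infty$ such that $|F_1(\lambda)|\le Ce^{\beta|\lambda|}$ for all $\lambda$ with $|\lambda|=r_n$ and $\pi/2+\delta\le\arg\lambda\le3\pi/2-\delta$. If $f_1$ is real, suppose moreover that $Kf_1\int_{\mathbb{R}}\frac{g(\omega)}{y-\omega}d\omega\neq1$ for every real zero $y$ of $g$, that is, that $T_1$ has no eigenvalue on the imaginary axis (this holds for all $K>0$ if $g$ has no real zero). Then $T_1$ generates a strongly continuous semigroup $e^{T_1t}$, and the linearized order parameter decays exponentially: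 there are constants $C'$ and $\gamma>0$ such that $|(e^{T_1t}q,P_0)|\le C'e^{-\gamma t}$ for all $t\ge0$. -/

import Mathlib

open MeasureTheory Filter Topology Complex

noncomputable section

namespace KuramotoDaido

/-- A probability density function on the real line (of the natural frequencies). -/
structure ProbDensity where
  /-- the density -/
  toFun : ℝ → ℝ
  nonneg : ∀ ω, 0 ≤ toFun ω
  integrable : Integrable toFun
  integral_eq_one : ∫ ω, toFun ω = 1

instance : CoeFun ProbDensity (fun _ => ℝ → ℝ) := ⟨ProbDensity.toFun⟩

/-- The measure `g(ω) dω`. -/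
def ProbDensity.measure (g : ProbDensity) : Measure ℝ :=
  volume.withDensity (fun ω => ENNReal.ofReal (g ω))

instance (g : ProbDensity) : IsProbabilityMeasure g.measure := by
  constructor
  rw [ProbDensity.measure, withDensity_apply _ MeasurableSet.univ, Measure.restrict_univ,
    ← ofReal_integral_eq_lintegral_ofReal g.integrable (Eventually.of_forall g.nonneg),
    g.integral_eq_one, ENNReal.ofReal_one]

/-- The complex Hilbert space `L²(ℝ, g(ω)dω)`. -/
abbrev ProbDensity.L2 (g : ProbDensity) : Type := Lp ℂ 2 g.measure

/-- The multiplication operator `(M u)(ω) = ω u(ω)` on `L²(ℝ, g(ω)dω)`, with its maximal domain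
`{u | ω u(ω) ∈ L²}`. -/
def mulOp (g : ProbDensity) : g.L2 →ₗ.[ℂ] g.L2 where
  domain :=
    { carrier := {u | MemLp (fun ω : ℝ => (ω : ℂ) * u ω) 2 g.measure}
      zero_mem' := by
        refine (memLp_congr_ae ?_).2 (MemLp.zero' (ε := ℂ))
        filter_upwards [Lp.coeFn_zero ℂ 2 g.measure] with ω h
        exact (congrArg (fun z => (ω : ℂ) * z) h).trans (mul_zero _)
      add_mem' := by
        intro u v hu hv
        refine (memLp_congr_ae ?_).2 (MemLp.add hu hv)
        filter_upwards [Lp.coeFn_add u v] with ω h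
        exact (congrArg (fun z => (ω : ℂ) * z) h).trans (mul_add _ _ _)
      smul_mem' := by
        intro c u hu
        refine (memLp_congr_ae ?_).2 (MemLp.const_smul hu c)
        filter_upwards [Lp.coeFn_smul c u] with ω h
        simp [h, mul_left_comm] }
  toFun :=
    { toFun := fun u => MemLp.toLp (fun ω : ℝ => (ω : ℂ) * (u : g.L2) ω) u.2
      map_add' := by
        intro u v
        rw [← MemLp.toLp_add]
        refine MemLp.toLp_congr _ _ ?_
        filter_upwards [Lp.coeFn_add (u : g.L2) (v : g.L2)] with ω h
        exact (congrArg (fun z => (ω : ℂ) * z) h).trans (mul_add _ _ _)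
      map_smul' := by
        intro c u
        rw [RingHom.id_apply, ← MemLp.toLp_const_smul]
        refine MemLp.toLp_congr _ _ ?_
        filter_upwards [Lp.coeFn_smul c (u : g.L2)] with ω h
        simp [h, mul_left_comm] }

/-- The constant function `P₀ = 1` as an element of `L²(ℝ, g(ω)dω)`. -/
def P0 (g : ProbDensity) : g.L2 := Lp.const 2 g.measure (1 : ℂ)

/-- The rank-one projection `P u = (u, P₀) P₀`. The inner product `(u, v) = ∫ u v̄ g dω`
(linear in the first argument) is `inner ℂ v u` in Mathlib's convention. -/
def projOp (g : ProbDensity) : g.L2 →ₗ[ℂ] g.L2 where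
  toFun u := inner ℂ (P0 g) u • P0 g
  map_add' u v := by rw [inner_add_right, add_smul]
  map_smul' c u := by rw [inner_smul_right, RingHom.id_apply, mul_smul]

/-- The operator `T₁ = i M + i K f₁ P` with domain that of `M`. -/
def T1 (g : ProbDensity) (K : ℝ) (f₁ : ℂ) : g.L2 →ₗ.[ℂ] g.L2 :=
  (I * K * f₁) • projOp g +ᵥ I • mulOp g

/-- A strongly continuous one-parameter semigroup `(S t)_{t ≥ 0}` of bounded operators
(values at negative times carry no meaning). -/
structure C0Semigroup (H : Type*) [NormedAddCommGroup H] [NormedSpace ℂ H] where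
  /-- the operator at time `t` -/
  toFun : ℝ → H →L[ℂ] H
  map_zero : toFun 0 = ContinuousLinearMap.id ℂ H
  map_add : ∀ s t, 0 ≤ s → 0 ≤ t → toFun (s + t) = (toFun s).comp (toFun t)
  continuousOn : ∀ x, ContinuousOn (fun t => toFun t x) (Set.Ici 0)

/-- `T` is the infinitesimal generator of `S`, that is, `S t = e^{T t}`: a pair `(x, y)` lies in the
graph of `T` if and only if `(S h x - x) / h → y` as `h → 0+`. -/
def C0Semigroup.IsGeneratedBy {H : Type*} [NormedAddCommGroup H] [NormedSpace ℂ H]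
    (S : C0Semigroup H) (T : H →ₗ.[ℂ] H) : Prop :=
  ∀ x y : H, (x, y) ∈ T.graph ↔
    Tendsto (fun h : ℝ => ((h⁻¹ : ℝ) : ℂ) • (S.toFun h x - x)) (𝓝[>] 0) (𝓝 y)

open Classical in
/-- `(z - T)⁻¹ q`: the solution `x` of `z x - T x = q` (and `0` if there is none). -/
def resolventApply {H : Type*} [NormedAddCommGroup H] [NormedSpace ℂ H]
    (T : H →ₗ.[ℂ] H) (z : ℂ) (q : H) : H :=
  if h : ∃ x : T.domain, z • (x : H) - T x = q then (h.choose : H) else 0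

/-- `((z - iM)⁻¹ q, P₀) = ∫ q(ω) g(ω) / (z - iω) dω`. -/
def freePairing (g : ProbDensity) (q : ℝ → ℂ) (z : ℂ) : ℂ :=
  ∫ ω : ℝ, q ω * g ω / (z - I * ω)

/-- `D(z) = ∫ g(ω) / (z - iω) dω`. -/
def stieltjesD (g : ProbDensity) (z : ℂ) : ℂ := ∫ ω : ℝ, (g ω : ℂ) / (z - I * ω)

/-- `F₀(z) = ((z - T₁)⁻¹ q, P₀)`, used for `Re z > 0`. -/
def F0 (g : ProbDensity) (K : ℝ) (f₁ : ℂ) (q : g.L2) (z : ℂ) : ℂ :=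
  inner ℂ (P0 g) (resolventApply (T1 g K f₁) z q)

/-- The continuation of `F₀` from the right to the left half plane, before the values at removable
singularities and at poles are normalised; `gs`, `qs` are the continuations of `g`, `q` to the upper
half plane. On the imaginary axis it is the boundary value from the right. -/
def F1pre (g : ProbDensity) (K : ℝ) (f₁ : ℂ) (q : ℝ → ℂ) (hq : MemLp q 2 g.measure)
    (gs qs : ℂ → ℂ) (z : ℂ) : ℂ :=
  if 0 < z.re then F0 g K f₁ (hq.toLp q) z
  else if z.re < 0 then
    (freePairing g q z + 2 * Real.pi * qs (-I * z) * gs (-I * z)) /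
      (1 - I * K * f₁ * stieltjesD g z - 2 * Real.pi * I * K * f₁ * gs (-I * z))
  else limUnder (𝓝[{w : ℂ | 0 < w.re}] z) (F0 g K f₁ (hq.toLp q))

/-- The meromorphic function `F₁` on `ℂ` that continues `F₀` (in normal form: removable
singularities are filled in, and the value at a pole is set to `0`). -/
def F1 (g : ProbDensity) (K : ℝ) (f₁ : ℂ) (q : ℝ → ℂ) (hq : MemLp q 2 g.measure)
    (gs qs : ℂ → ℂ) : ℂ → ℂ :=
  toMeromorphicNFOn (F1pre g K f₁ q hq gs qs) Set.univ

/-- `φs` continues the real analytic function `φ` meromorphically to the upper half plane. -/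
structure IsMeromorphicContinuation (φ : ℝ → ℂ) (φs : ℂ → ℂ) : Prop where
  eq_real : ∀ x : ℝ, φs x = φ x
  analyticAt_real : ∀ x : ℝ, AnalyticAt ℂ φs x
  meromorphicOn : MeromorphicOn φs {z | 0 < z.im}

/-- `φs` continues the real analytic function `φ` analytically to the upper half plane. -/
structure IsAnalyticContinuation (φ : ℝ → ℂ) (φs : ℂ → ℂ) : Prop where
  eq_real : ∀ x : ℝ, φs x = φ x
  analyticAt_real : ∀ x : ℝ, AnalyticAt ℂ φs x
  analyticOnNhd : AnalyticOnNhd ℂ φs {z | 0 < z.im}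

/-- The two closed sectors of half-opening `δ` around the positive and the negative imaginary
half-axis, `|arg z - π/2| ≤ δ` and `|arg z + π/2| ≤ δ`. -/
def verticalSectors (δ : ℝ) : Set ℂ := {z | |arg (-I * z)| ≤ δ ∨ |arg (I * z)| ≤ δ}

/-- The remaining sector `π/2 + δ ≤ arg z ≤ 3π/2 - δ` of the left half plane. -/
def leftSector (δ : ℝ) : Set ℂ := {z | |arg (-z)| ≤ Real.pi / 2 - δ}

/-- The growth conditions on `F`: for some `δ > 0`, `F(z) → 0` as `|z| → ∞` in the vertical sectors,
and `|F(z)| ≤ C e^{β|z|}` in the left sector. Since `F` may have poles there, the bound is asked for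
on arcs `|z| = r n` with `r n → ∞` only; a bound on the whole sector implies it. -/
def GrowthCondition (F : ℂ → ℂ) : Prop :=
  ∃ δ : ℝ, 0 < δ ∧
    Tendsto F (Bornology.cobounded ℂ ⊓ 𝓟 (verticalSectors δ)) (𝓝 0) ∧
    ∃ C β : ℝ, 0 < C ∧ 0 < β ∧ ∃ r : ℕ → ℝ, Tendsto r atTop atTop ∧
      ∀ n, ∀ z ∈ leftSector δ, ‖z‖ = r n → ‖F z‖ ≤ C * Real.exp (β * ‖z‖)

/-- Exponential decay of `Z(t)` as `t → ∞`. -/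
def DecaysExponentially (Z : ℝ → ℂ) : Prop :=
  ∃ C γ : ℝ, 0 < γ ∧ ∀ t, 0 ≤ t → ‖Z t‖ ≤ C * Real.exp (-γ * t)

end KuramotoDaido

end

/-!
`T₁` is a bounded perturbation of the multiplication operator `i M`, and it is dissipative because
`Re (i K f₁) ≤ 0`; so it generates a contraction semigroup, and the Laplace transform of the order
parameter `Z(t) = (e^{T₁ t} q, P₀)` is `F₀`. Cauchy integrals of analytic densities continue across
the imaginary axis with a jump `2π g*(-iz)`, which makes `F₁` the continuation of `F₀`;
dissipativity and the assumption on real zeros of `g` exclude poles of `F₁` on `Re z = 0`.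
Boundedness of `F₁` in the vertical sectors excludes poles high up near the imaginary axis and, by
Cauchy's estimate on discs of radius comparable to `|Im z|`, gives `F₁'' = O(|Im z|⁻²)` in a strip
`-γ ≤ Re z ≤ 1`. Since `F₁''` is the Laplace transform of `t² Z(t)`, the inversion formula for
`t² Z(t)` converges absolutely and its contour can be shifted to `Re z = -γ`.
-/

noncomputable section

namespace KuramotoDaido

open scoped NNReal BoundedContinuousFunction

section BoundedPerturbation

variable {E : Type*} [NormedAddCommGroup E] [NormedSpace ℂ E]

lemma mem_graph_vadd_iff {B : E →ₗ[ℂ] E} {T : E →ₗ.[ℂ] E} {x y : E} :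
    (x, y) ∈ (B +ᵥ T).graph ↔ (x, y - B x) ∈ T.graph := by
  simp only [LinearPMap.mem_graph_iff, LinearPMap.vadd_apply, LinearPMap.vadd_domain]
  refine exists_congr fun u => and_congr_right fun hu => ?_
  rw [← hu, eq_sub_iff_add_eq']

namespace C0Semigroup

variable (S : C0Semigroup E)

lemma continuous_orbit (x : E) : Continuous fun t : ℝ≥0 => S.toFun t x :=
  (S.continuousOn x).comp_continuous NNReal.continuous_coe fun t => t.2

lemma toFun_natCast (n : ℕ) : S.toFun n = S.toFun 1 ^ n := by
  induction n with
  | zero => rw [Nat.cast_zero, S.map_zero, pow_zero]; rfl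
  | succ n ih => rw [Nat.cast_succ, S.map_add _ _ n.cast_nonneg zero_le_one, ih, pow_succ]; rfl

lemma exists_norm_le_Icc [CompleteSpace E] (T : ℝ) :
    ∃ M, ∀ t ∈ Set.Icc 0 T, ‖S.toFun t‖ ≤ M := by
  obtain ⟨M, hM⟩ := banach_steinhaus (g := fun t : Set.Icc 0 T => S.toFun t) fun x => by
    obtain ⟨C, hC⟩ := isCompact_Icc.exists_bound_of_continuousOn
      ((S.continuousOn x).mono (Set.Icc_subset_Ici_self : Set.Icc 0 T ⊆ Set.Ici 0))
    exact ⟨C, fun t => hC t t.2⟩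
  exact ⟨M, fun t ht => hM ⟨t, ht⟩⟩

theorem exists_norm_le_mul_exp [CompleteSpace E] :
    ∃ M a : ℝ, ∀ t, 0 ≤ t → ‖S.toFun t‖ ≤ M * Real.exp (a * t) := by
  obtain ⟨M₀, hM₀⟩ := S.exists_norm_le_Icc 1
  set M := max M₀ 1
  have hM : ∀ t ∈ Set.Icc (0 : ℝ) 1, ‖S.toFun t‖ ≤ M := fun t ht =>
    (hM₀ t ht).trans (le_max_left _ _)
  have hM1 : 1 ≤ M := le_max_right _ _
  refine ⟨M, Real.log M, fun t ht => ?_⟩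
  have hsplit : S.toFun t = S.toFun 1 ^ ⌊t⌋₊ * S.toFun (t - ⌊t⌋₊) := by
    rw [← toFun_natCast]
    conv_lhs => rw [← add_sub_cancel (⌊t⌋₊ : ℝ) t]
    exact S.map_add _ _ (Nat.cast_nonneg _) (sub_nonneg.2 (Nat.floor_le ht))
  calc ‖S.toFun t‖ ≤ ‖S.toFun 1‖ ^ ⌊t⌋₊ * ‖S.toFun (t - ⌊t⌋₊)‖ := by
        rw [hsplit]
        rcases Nat.eq_zero_or_pos ⌊t⌋₊ with h | h
        · simp [h]
        · exact (norm_mul_le _ _).trans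
            (mul_le_mul_of_nonneg_right (norm_pow_le' _ h) (norm_nonneg _))
    _ ≤ M ^ ⌊t⌋₊ * M := by
        gcongr
        · exact hM 1 ⟨zero_le_one, le_rfl⟩
        · exact hM _ ⟨sub_nonneg.2 (Nat.floor_le ht),
            (sub_lt_iff_lt_add'.2 (Nat.lt_floor_add_one t)).le⟩
    _ ≤ M ^ t * M := by
        rw [← Real.rpow_natCast]
        gcongr
        exact Nat.floor_le ht
    _ = M * Real.exp (Real.log M * t) := by
        rw [Real.rpow_def_of_pos (by positivity), mul_comm]

lemma continuous_uncurry {M : ℝ≥0} (hM : ∀ t, 0 ≤ t → ‖S.toFun t‖ ≤ M) :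
    Continuous fun p : ℝ≥0 × E => S.toFun p.1 p.2 :=
  continuous_prod_of_continuous_lipschitzWith' _ M
    (fun t => (S.toFun t).lipschitz.weaken (hM t t.2)) S.continuous_orbit

/-- The rescaled semigroup `e^{ct} S(t)`. -/
def rescale (c : ℂ) : C0Semigroup E where
  toFun t := exp (c * t) • S.toFun t
  map_zero := by simp [S.map_zero]
  map_add s t hs ht := by
    ext x
    simp [S.map_add s t hs ht, mul_add, Complex.exp_add, smul_smul, mul_comm]
  continuousOn x := by
    have := S.continuousOn x
    exact ContinuousOn.smul (by fun_prop) this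

variable {S}

lemma IsGeneratedBy.vadd {S' : C0Semigroup E} {T : E →ₗ.[ℂ] E} (hS : S.IsGeneratedBy T)
    (B : E →ₗ[ℂ] E)
    (hB : ∀ x, Tendsto (fun h : ℝ => ((h⁻¹ : ℝ) : ℂ) • (S'.toFun h x - S.toFun h x)) (𝓝[>] 0)
      (𝓝 (B x))) : S'.IsGeneratedBy (B +ᵥ T) := by
  intro x y
  rw [mem_graph_vadd_iff, hS x]
  refine ⟨fun h => ?_, fun h => ?_⟩
  · simpa only [← smul_add, sub_add_sub_cancel', sub_add_cancel] using h.add (hB x)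
  · simpa only [← smul_sub, sub_sub_sub_cancel_left] using h.sub (hB x)

lemma IsGeneratedBy.rescale {T : E →ₗ.[ℂ] E} (hS : S.IsGeneratedBy T) (c : ℂ) :
    (S.rescale c).IsGeneratedBy ((c • LinearMap.id : E →ₗ[ℂ] E) +ᵥ T) := by
  refine hS.vadd _ fun x => ?_
  have hexp : Tendsto (fun h : ℝ => ((h⁻¹ : ℝ) : ℂ) * (exp (c * h) - 1)) (𝓝[>] 0) (𝓝 c) := by
    have h : HasDerivAt (fun t : ℝ => exp (c * t)) c 0 := by
      simpa using ((hasDerivAt_id (0 : ℝ)).ofReal_comp.const_mul c).cexp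
    simpa using h.tendsto_slope_zero_right
  have hx : Tendsto (fun h => S.toFun h x) (𝓝[>] 0) (𝓝 x) := by
    simpa [S.map_zero, ContinuousWithinAt] using
      (S.continuousOn x 0 Set.self_mem_Ici).mono_left (nhdsWithin_mono _ Set.Ioi_subset_Ici_self)
  refine (hexp.smul hx).congr fun h => ?_
  simp [C0Semigroup.rescale, mul_smul, sub_smul]

section Duhamel

variable (S : C0Semigroup E)

/-- The convolution `∫₀ᵗ S(t - s) f(s) ds` in the variation of constants formula. The truncations
`toNNReal` only fix values outside the interval of integration. -/
def duhamel (f : ℝ≥0 → E) (t : ℝ≥0) : E :=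
  ∫ s in (0 : ℝ)..t, S.toFun (t - s : ℝ).toNNReal (f s.toNNReal)

variable {S} {M : ℝ≥0} {f : ℝ≥0 → E}

lemma continuous_duhamel_integrand (hM : ∀ t, 0 ≤ t → ‖S.toFun t‖ ≤ M) (hf : Continuous f) :
    Continuous fun p : ℝ × ℝ => S.toFun (p.1 - p.2).toNNReal (f p.2.toNNReal) :=
  (S.continuous_uncurry hM).comp₂ (by fun_prop) (by fun_prop)

lemma intervalIntegrable_duhamel_integrand (hM : ∀ t, 0 ≤ t → ‖S.toFun t‖ ≤ M)
    (hf : Continuous f) (t a b : ℝ) :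
    IntervalIntegrable (fun s => S.toFun (t - s).toNNReal (f s.toNNReal)) volume a b :=
  ((continuous_duhamel_integrand hM hf).comp (by fun_prop : Continuous fun s : ℝ => (t, s)))
    |>.intervalIntegrable _ _

lemma continuous_duhamel (hM : ∀ t, 0 ≤ t → ‖S.toFun t‖ ≤ M) (hf : Continuous f) :
    Continuous (S.duhamel f) :=
  (intervalIntegral.continuous_parametric_intervalIntegral_of_continuous
    (f := fun t s : ℝ => S.toFun (t - s).toNNReal (f s.toNNReal))
    (continuous_duhamel_integrand hM hf) continuous_id).comp NNReal.continuous_coe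

lemma norm_le_of_norm_le_mul_exp_neg {a : ℝ} (ha : 0 ≤ a)
    (hS : ∀ t, 0 ≤ t → ‖S.toFun t‖ ≤ M * Real.exp (-a * t)) (t : ℝ) (ht : 0 ≤ t) :
    ‖S.toFun t‖ ≤ M :=
  (hS t ht).trans (mul_le_of_le_one_right M.2 (Real.exp_le_one_iff.2 (by nlinarith)))

lemma norm_duhamel_le {a C : ℝ} (ha : 0 < a)
    (hS : ∀ t, 0 ≤ t → ‖S.toFun t‖ ≤ M * Real.exp (-a * t)) (hC : ∀ t, ‖f t‖ ≤ C) (t : ℝ≥0) :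
    ‖S.duhamel f t‖ ≤ M / a * C := by
  have hC0 : 0 ≤ C := (norm_nonneg _).trans (hC 0)
  have hint : ∫ s in (0 : ℝ)..t, Real.exp (-a * (t - s)) = (1 - Real.exp (-a * t)) / a := by
    have hderiv : ∀ s ∈ Set.uIcc (0 : ℝ) t,
        HasDerivAt (fun s => Real.exp (-a * (t - s)) / a) (Real.exp (-a * (t - s))) s := fun s _ =>
      ((((hasDerivAt_id' s).const_sub (t : ℝ)).const_mul (-a)).exp.div_const a).congr_deriv
        (by field_simp)
    rw [intervalIntegral.integral_eq_sub_of_hasDerivAt hderiv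
      (Continuous.intervalIntegrable (by fun_prop) _ _)]
    simp [sub_div]
  calc ‖S.duhamel f t‖ ≤ ∫ s in (0 : ℝ)..t, M * C * Real.exp (-a * (t - s)) := by
        refine intervalIntegral.norm_integral_le_of_norm_le t.2
          (Eventually.of_forall fun s hs => ?_) (Continuous.intervalIntegrable (by fun_prop) _ _)
        rw [Real.coe_toNNReal _ (sub_nonneg.2 hs.2), mul_right_comm]
        exact (ContinuousLinearMap.le_opNorm _ _).trans
          (mul_le_mul (hS _ (sub_nonneg.2 hs.2)) (hC _) (norm_nonneg _) (by positivity))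
    _ = M * C * ((1 - Real.exp (-a * t)) / a) := by rw [intervalIntegral.integral_const_mul, hint]
    _ ≤ M * C * (1 / a) := by gcongr; exact sub_le_self _ (Real.exp_nonneg _)
    _ = M / a * C := by ring

lemma duhamel_add [CompleteSpace E] (hM : ∀ t, 0 ≤ t → ‖S.toFun t‖ ≤ M) (hf : Continuous f)
    (t s : ℝ≥0) :
    S.duhamel f (t + s) = S.toFun t (S.duhamel f s) + S.duhamel (fun r => f (r + s)) t := by
  have hint := intervalIntegrable_duhamel_integrand hM hf
  unfold duhamel
  rw [← intervalIntegral.integral_add_adjacent_intervals (hint _ 0 s) (hint _ s _),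
    ← ContinuousLinearMap.intervalIntegral_comp_comm _ (hint _ _ _)]
  congr 1
  · refine intervalIntegral.integral_congr fun r hr => ?_
    rw [Set.uIcc_of_le s.coe_nonneg] at hr
    have hadd : ((t + s : ℝ≥0) - r : ℝ).toNNReal = (t : ℝ) + (s - r : ℝ).toNNReal := by
      rw [Real.coe_toNNReal _ (sub_nonneg.2 hr.2), Real.coe_toNNReal]
      · push_cast; ring
      · push_cast; linarith [hr.2, t.2]
    simp only [hadd]
    rw [S.map_add _ _ t.coe_nonneg (NNReal.coe_nonneg _), ContinuousLinearMap.comp_apply]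
  · have := intervalIntegral.integral_comp_add_right (a := 0) (b := t)
      (fun r => S.toFun ((t + s : ℝ≥0) - r : ℝ).toNNReal (f r.toNNReal)) s
    rw [zero_add, ← NNReal.coe_add] at this
    rw [← this]
    refine intervalIntegral.integral_congr fun r hr => ?_
    rw [Set.uIcc_of_le t.coe_nonneg] at hr
    simp only [NNReal.coe_add, add_sub_add_right_eq_sub, Real.toNNReal_add hr.1 s.coe_nonneg,
      Real.toNNReal_coe]

lemma tendsto_inv_smul_duhamel [CompleteSpace E] (hM : ∀ t, 0 ≤ t → ‖S.toFun t‖ ≤ M)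
    (hf : Continuous f) :
    Tendsto (fun h : ℝ => ((h⁻¹ : ℝ) : ℂ) • S.duhamel f h.toNNReal) (𝓝[>] 0) (𝓝 (f 0)) := by
  have hF := continuous_duhamel_integrand hM hf
  have hmean : Continuous fun h : ℝ =>
      ∫ u in (0 : ℝ)..1, S.toFun (h - h * u).toNNReal (f (h * u).toNNReal) :=
    intervalIntegral.continuous_parametric_intervalIntegral_of_continuous'
      (f := fun h u : ℝ => S.toFun (h - h * u).toNNReal (f (h * u).toNNReal))
      (hF.comp (by fun_prop : Continuous fun p : ℝ × ℝ => (p.1, p.1 * p.2))) 0 1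
  have hlim := (hmean.tendsto 0).mono_left (nhdsWithin_le_nhds (s := Set.Ioi 0))
  simp only [zero_mul, sub_zero, Real.toNNReal_zero, NNReal.coe_zero, S.map_zero,
    ContinuousLinearMap.id_apply, intervalIntegral.integral_const, one_smul] at hlim
  refine hlim.congr' (eventually_mem_nhdsWithin.mono fun h (hh : 0 < h) => ?_)
  dsimp only
  have := intervalIntegral.smul_integral_comp_mul_left (a := 0) (b := 1)
    (fun s => S.toFun (h - s).toNNReal (f s.toNNReal)) h
  rw [mul_zero, mul_one] at this
  rw [duhamel, Real.coe_toNNReal _ hh.le, ← this, Complex.coe_smul, smul_smul,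
    inv_mul_cancel₀ hh.ne', one_smul]

lemma exists_orbit (hM : ∀ t, 0 ≤ t → ‖S.toFun t‖ ≤ M) :
    ∃ O : E →L[ℂ] (ℝ≥0 →ᵇ E), ∀ x t, O x t = S.toFun t x := by
  have hbound : ∀ x (t : ℝ≥0), ‖S.toFun t x‖ ≤ M * ‖x‖ := fun x t =>
    (S.toFun t).le_of_opNorm_le (hM t t.2) x
  exact ⟨LinearMap.mkContinuous
    { toFun := fun x => .ofNormedAddCommGroup _ (S.continuous_orbit x) _ (hbound x)
      map_add' := fun x y => by ext t; simp
      map_smul' := fun c x => by ext t; simp } M fun x =>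
    BoundedContinuousFunction.norm_ofNormedAddCommGroup_le _ (by positivity) (hbound x),
    fun x t => rfl⟩

lemma exists_volterra {a : ℝ} (ha : 0 < a)
    (hS : ∀ t, 0 ≤ t → ‖S.toFun t‖ ≤ M * Real.exp (-a * t)) (B : E →L[ℂ] E) :
    ∃ A : (ℝ≥0 →ᵇ E) →L[ℂ] (ℝ≥0 →ᵇ E), ‖A‖ ≤ M / a * ‖B‖ ∧
      ∀ u t, A u t = S.duhamel (fun s => B (u s)) t := by
  have hM := norm_le_of_norm_le_mul_exp_neg ha.le hS
  have hBu : ∀ u : ℝ≥0 →ᵇ E, Continuous fun s => B (u s) := fun u => B.continuous.comp u.continuous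
  have hint : ∀ (u : ℝ≥0 →ᵇ E) (t : ℝ≥0), IntervalIntegrable
      (fun s => S.toFun (t - s : ℝ).toNNReal (B (u s.toNNReal))) volume 0 t := fun u t =>
    intervalIntegrable_duhamel_integrand hM (hBu u) _ _ _
  have hbound : ∀ (u : ℝ≥0 →ᵇ E) t, ‖S.duhamel (fun s => B (u s)) t‖ ≤ M / a * (‖B‖ * ‖u‖) :=
    fun u => norm_duhamel_le ha hS fun t => B.le_opNorm_of_le (u.norm_coe_le_norm t)
  refine ⟨LinearMap.mkContinuous
    { toFun := fun u => .ofNormedAddCommGroup _ (continuous_duhamel hM (hBu u)) _ (hbound u)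
      map_add' := fun u v => by
        ext t
        simpa [duhamel] using intervalIntegral.integral_add (hint u t) (hint v t)
      map_smul' := fun c u => by ext t; simp [duhamel] } (M / a * ‖B‖) fun u => ?_,
    LinearMap.mkContinuous_norm_le _ (by positivity) _, fun u t => rfl⟩
  rw [mul_assoc]
  exact BoundedContinuousFunction.norm_ofNormedAddCommGroup_le _ (by positivity) (hbound u)

theorem exists_mildSolution [CompleteSpace E] {a : ℝ} (ha : 0 < a)
    (hS : ∀ t, 0 ≤ t → ‖S.toFun t‖ ≤ M * Real.exp (-a * t)) {B : E →L[ℂ] E}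
    (hB : M / a * ‖B‖ < 1) :
    ∃ V : E →L[ℂ] (ℝ≥0 →ᵇ E), ∀ x (u : ℝ≥0 →ᵇ E),
      u = V x ↔ ∀ t : ℝ≥0, u t = S.toFun t x + S.duhamel (fun s => B (u s)) t := by
  obtain ⟨O, hO⟩ := exists_orbit (norm_le_of_norm_le_mul_exp_neg ha.le hS)
  obtain ⟨A, hA_norm, hA⟩ := exists_volterra ha hS B
  have hunit : IsUnit (1 - A) := isUnit_one_sub_of_norm_lt_one (hA_norm.trans_lt hB)
  refine ⟨Ring.inverse (1 - A) ∘L O, fun x u => ?_⟩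
  have hsolve : u = Ring.inverse (1 - A) (O x) ↔ (1 - A) u = O x := by
    refine ⟨fun h => ?_, fun h => ?_⟩
    · rw [h, ← mul_apply_eq_comp, Ring.mul_inverse_cancel _ hunit,
        one_apply_eq_self]
    · rw [← h, ← mul_apply_eq_comp, Ring.inverse_mul_cancel _ hunit,
        one_apply_eq_self]
  rw [ContinuousLinearMap.comp_apply, hsolve, sub_apply,
    one_apply_eq_self, sub_eq_iff_eq_add, BoundedContinuousFunction.ext_iff]
  simp only [BoundedContinuousFunction.add_apply, hO, hA]

theorem exists_isGeneratedBy_vadd_of_stable [CompleteSpace E] {T : E →ₗ.[ℂ] E}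
    (hT : S.IsGeneratedBy T) {a : ℝ} (ha : 0 < a)
    (hS : ∀ t, 0 ≤ t → ‖S.toFun t‖ ≤ M * Real.exp (-a * t)) {B : E →L[ℂ] E}
    (hB : M / a * ‖B‖ < 1) :
    ∃ S' : C0Semigroup E, S'.IsGeneratedBy ((B : E →ₗ[ℂ] E) +ᵥ T) := by
  have hM := norm_le_of_norm_le_mul_exp_neg ha.le hS
  obtain ⟨V, hV⟩ := exists_mildSolution ha hS hB
  have hBV : ∀ x, Continuous fun s => B (V x s) := fun x => B.continuous.comp (V x).continuous
  have hVeq : ∀ x t, V x t = S.toFun t x + S.duhamel (fun s => B (V x s)) t := fun x =>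
    (hV x _).1 rfl
  have hV_zero : ∀ x, V x 0 = x := fun x => by simp [hVeq x 0, duhamel, S.map_zero]
  have hV_add : ∀ x s t, V x (t + s) = V (V x s) t := fun x s t => by
    let shift : ℝ≥0 →ᵇ E := (V x).compContinuous ⟨(· + s), by fun_prop⟩
    suffices shift = V (V x s) from DFunLike.congr_fun this t
    refine (hV _ _).2 fun t => ?_
    have hshift : S.duhamel (fun r => B (V x r)) (t + s) =
        S.toFun t (S.duhamel (fun r => B (V x r)) s) + S.duhamel (fun r => B (shift r)) t :=
      duhamel_add hM (hBV x) t s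
    rw [hVeq x s, _root_.map_add, add_assoc, ← hshift, ← ContinuousLinearMap.comp_apply,
      ← S.map_add _ _ t.coe_nonneg s.coe_nonneg]
    exact hVeq x (t + s)
  let S' : C0Semigroup E :=
    { toFun := fun t => (BoundedContinuousFunction.evalCLM ℂ t.toNNReal) ∘L V
      map_zero := by ext x; simpa using hV_zero x
      map_add := fun s t hs ht => by
        ext x
        simpa [Real.toNNReal_add hs ht] using hV_add x _ _
      continuousOn := fun x => ((V x).continuous.comp continuous_real_toNNReal).continuousOn }
  refine ⟨S', hT.vadd _ fun x => ?_⟩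
  have hlim := tendsto_inv_smul_duhamel hM (hBV x)
  rw [hV_zero] at hlim
  refine hlim.congr' (eventually_mem_nhdsWithin.mono fun h (hh : 0 < h) => ?_)
  change _ = ((h⁻¹ : ℝ) : ℂ) • (V x h.toNNReal - S.toFun h x)
  rw [hVeq, Real.coe_toNNReal _ hh.le, add_sub_cancel_left]

-- Rescaling by a large `e^{-at}` makes the Volterra operator of the mild equation a contraction.
theorem IsGeneratedBy.exists_vadd [CompleteSpace E] {T : E →ₗ.[ℂ] E} (hT : S.IsGeneratedBy T)
    (B : E →L[ℂ] E) : ∃ S' : C0Semigroup E, S'.IsGeneratedBy ((B : E →ₗ[ℂ] E) +ᵥ T) := by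
  obtain ⟨M₀, ω, hS⟩ := S.exists_norm_le_mul_exp
  set M := M₀.toNNReal
  set a : ℝ := M * ‖B‖ + 1
  have ha : 0 < a := by positivity
  have hS' : ∀ t, 0 ≤ t → ‖(S.rescale (-(ω + a : ℝ))).toFun t‖ ≤ M * Real.exp (-a * t) :=
    fun t ht => by
    calc ‖(S.rescale (-(ω + a : ℝ))).toFun t‖
        ≤ Real.exp (-(ω + a) * t) * (M * Real.exp (ω * t)) := by
          rw [C0Semigroup.rescale, norm_smul, Complex.norm_exp]
          gcongr
          · simp
          · exact (hS t ht).trans (by gcongr; exact Real.le_coe_toNNReal _)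
      _ = M * Real.exp (-a * t) := by
          rw [mul_left_comm, ← Real.exp_add]; ring_nf
  obtain ⟨S', hS'⟩ := exists_isGeneratedBy_vadd_of_stable (hT.rescale _) ha hS' (B := B)
    (by rw [div_mul_eq_mul_div, div_lt_one ha]; exact lt_add_one _)
  refine ⟨S'.rescale (ω + a : ℝ), ?_⟩
  convert hS'.rescale (ω + a : ℝ) using 1
  rw [vadd_vadd, vadd_vadd, add_right_comm, ← add_smul]
  simp

end Duhamel

end C0Semigroup

end BoundedPerturbation

section DominatedConvergence

variable {α E ι : Type*} [MeasurableSpace α] {μ : Measure α} [NormedAddCommGroup E]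
  {p : ENNReal} {l : Filter ι} [l.IsCountablyGenerated]

lemma tendsto_eLpNorm_zero_of_dominated (hp_zero : p ≠ 0) (hp_top : p ≠ ⊤) {f : ι → α → E}
    (hf : ∀ i, AEStronglyMeasurable (f i) μ) {b : α → ℝ} (hb : MemLp b p μ)
    (hbound : ∀ᶠ i in l, ∀ᵐ a ∂μ, ‖f i a‖ ≤ b a)
    (hlim : ∀ᵐ a ∂μ, Tendsto (fun i => f i a) l (𝓝 0)) :
    Tendsto (fun i => eLpNorm (f i) p μ) l (𝓝 0) := by
  have hp_pos := ENNReal.toReal_pos hp_zero hp_top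
  have hlintegral : Tendsto (fun i => ∫⁻ a, ‖f i a‖ₑ ^ p.toReal ∂μ) l (𝓝 (∫⁻ _, 0 ∂μ)) := by
    refine tendsto_lintegral_filter_of_dominated_convergence' (fun a => ‖b a‖ₑ ^ p.toReal)
      (Eventually.of_forall fun i => (hf i).enorm.pow_const _) ?_
      ((eLpNorm_lt_top_iff_lintegral_rpow_enorm_lt_top hp_zero hp_top).1 hb.2).ne ?_
    · filter_upwards [hbound] with i hi
      filter_upwards [hi] with a ha
      gcongr
      exact enorm_le_iff_norm_le.2 (ha.trans (le_abs_self _))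
    · filter_upwards [hlim] with a ha
      simpa [hp_pos] using ha.enorm.ennrpow_const p.toReal
  simp only [eLpNorm_eq_lintegral_rpow_enorm_toReal hp_zero hp_top]
  simpa [hp_pos] using hlintegral.ennrpow_const (1 / p.toReal)

lemma tendsto_Lp_of_dominated [Fact (1 ≤ p)] (hp_top : p ≠ ⊤) {F : ι → Lp E p μ} {f : Lp E p μ}
    (G : ι → α → E) (hG : ∀ i, F i =ᵐ[μ] G i) {b : α → ℝ} (hb : MemLp b p μ)
    (hbound : ∀ᶠ i in l, ∀ᵐ a ∂μ, ‖G i a - f a‖ ≤ b a)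
    (hlim : ∀ᵐ a ∂μ, Tendsto (fun i => G i a) l (𝓝 (f a))) : Tendsto F l (𝓝 f) := by
  rw [Lp.tendsto_Lp_iff_tendsto_eLpNorm']
  refine (tendsto_eLpNorm_zero_of_dominated (f := fun i a => G i a - f a)
    (zero_lt_one.trans_le Fact.out).ne' hp_top (fun i => ?_) hb hbound ?_).congr fun i =>
      eLpNorm_congr_ae ((hG i).symm.sub (ae_eq_refl f))
  · exact ((Lp.aestronglyMeasurable (F i)).congr (hG i)).sub (Lp.aestronglyMeasurable f)
  · filter_upwards [hlim] with a ha
    simpa using ha.sub_const (f a)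

end DominatedConvergence

section MultiplicationSemigroup

variable (g : ProbDensity)

/-- The operator `e^{iMt}`, multiplication by the bounded function `e^{iωt}`. -/
def expMul (t : ℝ) : g.L2 →L[ℂ] g.L2 :=
  (ContinuousLinearMap.mul ℂ ℂ).holderL g.measure ⊤ 2 2
    (memLp_top_of_bound (f := fun ω : ℝ => exp (I * ω * t)) (by fun_prop) 1
      (Eventually.of_forall fun ω => by simp [Complex.norm_exp])).toLp

lemma expMul_coeFn (t : ℝ) (u : g.L2) :
    expMul g t u =ᵐ[g.measure] fun ω : ℝ => exp (I * ω * t) * u ω := by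
  filter_upwards [(ContinuousLinearMap.mul ℂ ℂ).coeFn_holder (p := ⊤) (q := 2) (r := 2) _ u,
    MemLp.coeFn_toLp (memLp_top_of_bound (μ := g.measure) (f := fun ω : ℝ => exp (I * ω * t))
      (by fun_prop) 1 (Eventually.of_forall fun ω => by simp [Complex.norm_exp]))] with ω h₁ h₂
  exact h₁.trans (congrArg (· * u ω) h₂)

/-- The semigroup `e^{iMt}`. -/
def expMulSemigroup : C0Semigroup g.L2 where
  toFun := expMul g
  map_zero := by
    ext1 u
    refine Lp.ext ?_
    filter_upwards [expMul_coeFn g 0 u] with ω h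
    simp [h]
  map_add s t _ _ := by
    ext1 u
    refine Lp.ext ?_
    filter_upwards [expMul_coeFn g (s + t) u, expMul_coeFn g s (expMul g t u), expMul_coeFn g t u]
      with ω hst hs ht
    rw [ContinuousLinearMap.comp_apply, hst, hs, ht, ofReal_add, mul_add, Complex.exp_add,
      mul_assoc]
  continuousOn u := by
    refine Continuous.continuousOn (continuous_iff_continuousAt.2 fun t => ?_)
    refine tendsto_Lp_of_dominated ENNReal.ofNat_ne_top (fun s (ω : ℝ) => exp (I * ω * s) * u ω)
      (b := fun ω => 2 * ‖u ω‖) (expMul_coeFn g · u) ((Lp.memLp u).norm.const_mul 2)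
      (Eventually.of_forall fun s => ?_) ?_
    · filter_upwards [expMul_coeFn g t u] with ω h
      rw [h]
      refine (norm_sub_le _ _).trans_eq ?_
      simp [Complex.norm_exp, two_mul]
    · filter_upwards [expMul_coeFn g t u] with ω h
      rw [h]
      exact (by fun_prop : Continuous fun s : ℝ => exp (I * ω * s) * u ω).tendsto t

lemma mulOp_coeFn (u : (mulOp g).domain) :
    mulOp g u =ᵐ[g.measure] fun ω : ℝ => (ω : ℂ) * (u : g.L2) ω :=
  MemLp.coeFn_toLp u.2

lemma mem_graph_I_smul_mulOp_iff {u v : g.L2} :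
    (u, v) ∈ (I • mulOp g).graph ↔ v =ᵐ[g.measure] fun ω : ℝ => I * (ω * u ω) := by
  rw [LinearPMap.mem_graph_iff]
  constructor
  · rintro ⟨u, rfl, rfl⟩
    filter_upwards [Lp.coeFn_smul I (mulOp g u), mulOp_coeFn g u] with ω h₁ h₂
    exact h₁.trans (congrArg (I * ·) h₂)
  · intro hv
    have hu : u ∈ (mulOp g).domain := by
      refine (memLp_congr_ae ?_).2 ((Lp.memLp v).const_mul (-I))
      filter_upwards [hv] with ω h
      rw [h, ← mul_assoc, neg_mul, I_mul_I, neg_neg, one_mul]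
    refine ⟨⟨u, hu⟩, rfl, Lp.ext ?_⟩
    filter_upwards [hv, Lp.coeFn_smul I (mulOp g ⟨u, hu⟩), mulOp_coeFn g ⟨u, hu⟩] with ω h₁ h₂ h₃
    rw [h₁]
    exact h₂.trans (congrArg (I * ·) h₃)

lemma tendsto_exp_sub_one_div (ω : ℝ) (z : ℂ) :
    Tendsto (fun h : ℝ => ((h⁻¹ : ℝ) : ℂ) * (exp (I * ω * h) * z - z)) (𝓝[>] 0)
      (𝓝 (I * (ω * z))) := by
  have hderiv : HasDerivAt (fun h : ℝ => exp (I * ω * h) * z) (I * (ω * z)) 0 := by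
    simpa [mul_assoc] using
      (((hasDerivAt_id (0 : ℂ)).const_mul (I * ω)).cexp.mul_const z).comp_ofReal (z := 0)
  simpa using hderiv.tendsto_slope_zero_right

lemma norm_exp_sub_one_div_le {h : ℝ} (hh : 0 < h) (ω : ℝ) (z : ℂ) :
    ‖((h⁻¹ : ℝ) : ℂ) * (exp (I * ω * h) * z - z)‖ ≤ ‖(ω : ℂ) * z‖ := by
  have hexp : ‖exp (I * ω * h) - 1‖ ≤ h * |ω| := by
    calc ‖exp (I * ω * h) - 1‖ = ‖exp (I * ↑(ω * h)) - 1‖ := by rw [ofReal_mul, mul_assoc]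
      _ ≤ ‖ω * h‖ := Real.norm_exp_I_mul_ofReal_sub_one_le
      _ = h * |ω| := by rw [Real.norm_eq_abs, abs_mul, abs_of_pos hh, mul_comm]
  calc ‖((h⁻¹ : ℝ) : ℂ) * (exp (I * ω * h) * z - z)‖ = h⁻¹ * (‖exp (I * ω * h) - 1‖ * ‖z‖) := by
        rw [← sub_one_mul, norm_mul, norm_mul, norm_real, Real.norm_of_nonneg (by positivity)]
    _ ≤ h⁻¹ * (h * |ω| * ‖z‖) := by gcongr
    _ = ‖(ω : ℂ) * z‖ := by
        rw [norm_mul, norm_real, Real.norm_eq_abs, mul_assoc, inv_mul_cancel_left₀ hh.ne']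

lemma expMulSemigroup_isGeneratedBy : (expMulSemigroup g).IsGeneratedBy (I • mulOp g) := by
  intro u v
  have hquot : ∀ h : ℝ, ⇑(((h⁻¹ : ℝ) : ℂ) • (expMul g h u - u)) =ᵐ[g.measure]
      fun ω : ℝ => ((h⁻¹ : ℝ) : ℂ) * (exp (I * ω * h) * u ω - u ω) := fun h => by
    filter_upwards [Lp.coeFn_smul ((h⁻¹ : ℝ) : ℂ) (expMul g h u - u),
      Lp.coeFn_sub (expMul g h u) u, expMul_coeFn g h u] with ω h₁ h₂ h₃
    rw [h₁, Pi.smul_apply, h₂, Pi.sub_apply, h₃, smul_eq_mul]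
  rw [mem_graph_I_smul_mulOp_iff]
  constructor
  · intro hv
    refine tendsto_Lp_of_dominated ENNReal.ofNat_ne_top _ hquot
      ((Lp.memLp v).norm.const_mul 2) ?_ ?_
    · filter_upwards [self_mem_nhdsWithin] with h (hh : 0 < h)
      filter_upwards [hv] with ω hω
      rw [hω, two_mul]
      refine (norm_sub_le _ _).trans (add_le_add_left ?_ _)
      simpa using norm_exp_sub_one_div_le hh ω (u ω)
    · filter_upwards [hv] with ω hω
      rw [hω]
      exact tendsto_exp_sub_one_div ω (u ω)
  · intro hlim
    obtain ⟨h, hh, hae⟩ := (tendstoInMeasure_of_tendsto_Lp hlim).exists_seq_tendsto_ae'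
    filter_upwards [hae, ae_all_iff.2 fun n => hquot (h n)] with ω hω hω_quot
    refine tendsto_nhds_unique hω (((tendsto_exp_sub_one_div ω (u ω)).comp hh).congr fun n => ?_)
    exact (hω_quot n).symm

end MultiplicationSemigroup

theorem exists_isGeneratedBy_T1 (g : ProbDensity) (K : ℝ) (f₁ : ℂ) :
    ∃ S : C0Semigroup g.L2, S.IsGeneratedBy (T1 g K f₁) :=
  (expMulSemigroup_isGeneratedBy g).exists_vadd
    ((I * K * f₁) • InnerProductSpace.rankOne ℂ (P0 g) (P0 g))

section LaplaceTransform

variable {E : Type*} [NormedAddCommGroup E] [NormedSpace ℂ E] {f : ℝ → E} {B : ℝ} {z : ℂ}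

/-- The Laplace transform `z ↦ ∫₀^∞ e^{-zt} f(t) dt` of a vector-valued function; it is `0` by
convention where the integral diverges. -/
def laplaceTransform (f : ℝ → E) (z : ℂ) : E := ∫ t in Set.Ioi (0 : ℝ), exp (-(z * t)) • f t

lemma norm_exp_neg_mul_smul (z : ℂ) (t : ℝ) (x : E) :
    ‖exp (-(z * t)) • x‖ = Real.exp (-z.re * t) * ‖x‖ := by
  rw [norm_smul, Complex.norm_exp, neg_re, re_mul_ofReal, neg_mul]

lemma continuousOn_exp_neg_mul_smul {s : Set ℝ} (hf : ContinuousOn f s) (z : ℂ) :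
    ContinuousOn (fun t : ℝ => exp (-(z * t)) • f t) s :=
  (Continuous.continuousOn (by fun_prop)).smul hf

lemma aestronglyMeasurable_exp_neg_mul_smul (hf : ContinuousOn f (Set.Ici 0)) (z : ℂ) :
    AEStronglyMeasurable (fun t : ℝ => exp (-(z * t)) • f t) (volume.restrict (Set.Ioi 0)) :=
  (continuousOn_exp_neg_mul_smul (hf.mono Set.Ioi_subset_Ici_self) z).aestronglyMeasurable
    measurableSet_Ioi

lemma integrableOn_pow_mul_exp_neg (n : ℕ) {a : ℝ} (ha : 0 < a) :
    IntegrableOn (fun t : ℝ => t ^ n * Real.exp (-a * t)) (Set.Ioi 0) := by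
  simpa using integrableOn_rpow_mul_exp_neg_mul_rpow (s := n)
    (by linarith [n.cast_nonneg (α := ℝ)]) one_pos ha

lemma integrableOn_exp_neg_mul_smul (hf : ContinuousOn f (Set.Ici 0)) {n : ℕ}
    (hb : ∀ t, 0 ≤ t → ‖f t‖ ≤ B * t ^ n) (hz : 0 < z.re) :
    IntegrableOn (fun t : ℝ => exp (-(z * t)) • f t) (Set.Ioi 0) := by
  refine Integrable.mono' ((integrableOn_pow_mul_exp_neg n hz).const_mul B)
    (aestronglyMeasurable_exp_neg_mul_smul hf z) ?_
  filter_upwards [ae_restrict_mem measurableSet_Ioi] with t (ht : 0 < t)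
  rw [norm_exp_neg_mul_smul, ← mul_assoc, mul_comm]
  gcongr
  exact hb t ht.le

lemma tendsto_exp_neg_mul_smul (hb : ∀ t, 0 ≤ t → ‖f t‖ ≤ B) (hz : 0 < z.re) :
    Tendsto (fun t : ℝ => exp (-(z * t)) • f t) atTop (𝓝 0) := by
  refine squeeze_zero_norm' (a := fun t : ℝ => Real.exp (-z.re * t) * B)
    ((eventually_ge_atTop 0).mono fun t ht => ?_) ?_
  · rw [norm_exp_neg_mul_smul]
    gcongr
    exact hb t ht
  · simpa using (Real.tendsto_exp_atBot.comp
      (tendsto_id.const_mul_atTop_of_neg (neg_lt_zero.2 hz))).mul_const B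

end LaplaceTransform

section Orbits

variable {E : Type*} [NormedAddCommGroup E] [NormedSpace ℂ E] {S : C0Semigroup E}
  {T : E →ₗ.[ℂ] E} {x y : E}

namespace C0Semigroup

lemma IsGeneratedBy.apply_mem_graph (hS : S.IsGeneratedBy T) (hxy : (x, y) ∈ T.graph) {t : ℝ}
    (ht : 0 ≤ t) : (S.toFun t x, S.toFun t y) ∈ T.graph := by
  rw [hS]
  refine (((S.toFun t).continuous.tendsto y).comp ((hS x y).1 hxy)).congr' ?_
  filter_upwards [self_mem_nhdsWithin] with h (hh : 0 < h)
  simp only [Function.comp_apply, map_smul, map_sub]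
  rw [← ContinuousLinearMap.comp_apply, ← ContinuousLinearMap.comp_apply, ← S.map_add t h ht hh.le,
    ← S.map_add h t hh.le ht, add_comm]

lemma IsGeneratedBy.hasDerivWithinAt (hS : S.IsGeneratedBy T) (hxy : (x, y) ∈ T.graph) {t : ℝ}
    (ht : 0 ≤ t) : HasDerivWithinAt (fun s => S.toFun s x) (S.toFun t y) (Set.Ioi t) t := by
  rw [hasDerivWithinAt_iff_tendsto_slope' (by simp)]
  have hshift : Tendsto (fun s : ℝ => s - t) (𝓝[>] t) (𝓝[>] 0) := by
    refine tendsto_nhdsWithin_iff.2 ⟨tendsto_nhdsWithin_of_tendsto_nhds ?_, ?_⟩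
    · exact Continuous.tendsto' (by fun_prop) _ _ (sub_self t)
    · filter_upwards [self_mem_nhdsWithin] with s hs using sub_pos.2 (Set.mem_Ioi.1 hs)
  refine (((hS _ _).1 (hS.apply_mem_graph hxy ht)).comp hshift).congr' ?_
  filter_upwards [self_mem_nhdsWithin] with s (hs : t < s)
  rw [Function.comp_apply, slope_def_module, ← ContinuousLinearMap.comp_apply,
    ← S.map_add (s - t) t (sub_nonneg.2 hs.le) ht, sub_add_cancel]
  rfl

end C0Semigroup

lemma C0Semigroup.IsGeneratedBy.laplaceTransform_apply [CompleteSpace E]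
    (hS : S.IsGeneratedBy T) (hcontr : ∀ t, 0 ≤ t → ∀ x, ‖S.toFun t x‖ ≤ ‖x‖) {z : ℂ}
    (hz : 0 < z.re) (hx : (x, z • x - y) ∈ T.graph) :
    laplaceTransform (fun t => S.toFun t y) z = x := by
  have hcont := fun w => continuousOn_exp_neg_mul_smul (S.continuousOn w) z
  have hFTC : ∀ R : ℝ, 0 ≤ R → ∫ t in (0 : ℝ)..R, exp (-(z * t)) • S.toFun t y =
      x - exp (-(z * R)) • S.toFun R x := fun R hR => by
    rw [intervalIntegral.integral_eq_sub_of_hasDeriv_right_of_le hR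
      (f := fun t : ℝ => -(exp (-(z * t)) • S.toFun t x))
      ((hcont x).mono Set.Icc_subset_Ici_self).neg (fun t ht => ?_)
      (((hcont y).mono (Set.uIcc_of_le hR ▸ Set.Icc_subset_Ici_self)).intervalIntegrable)]
    · simp [S.map_zero, neg_add_eq_sub]
    · have hexp : HasDerivWithinAt (fun t : ℝ => exp (-(z * t))) (exp (-(z * t)) * -z)
          (Set.Ioi t) t := by
        simpa using (((hasDerivAt_id (t : ℂ)).const_mul z).neg.cexp.comp_ofReal).hasDerivWithinAt
      refine (hexp.smul (hS.hasDerivWithinAt hx ht.1.le)).neg.congr_deriv ?_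
      simp only [map_sub, map_smul]
      module
  have hlim : Tendsto (fun R : ℝ => x - exp (-(z * R)) • S.toFun R x) atTop (𝓝 x) := by
    simpa using (tendsto_exp_neg_mul_smul (fun t ht => hcontr t ht x) hz).const_sub x
  have hint := integrableOn_exp_neg_mul_smul (n := 0) (S.continuousOn y)
    (fun t ht => by simpa using hcontr t ht y) hz
  refine tendsto_nhds_unique
    ((intervalIntegral_tendsto_integral_Ioi 0 hint tendsto_id).congr' ?_) hlim
  filter_upwards [eventually_ge_atTop 0] with R hR using hFTC R hR

end Orbits

section Dissipative

variable {H : Type*} [NormedAddCommGroup H] [InnerProductSpace ℂ H] {T : H →ₗ.[ℂ] H}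
  {c z : ℂ} {p q w x : H}

/-- `T` is dissipative: `Re (T x, x) ≤ 0` for all `x` in its domain. -/
def IsDissipative (T : H →ₗ.[ℂ] H) : Prop := ∀ x y, (x, y) ∈ T.graph → (inner ℂ x y).re ≤ 0

lemma C0Semigroup.IsGeneratedBy.norm_apply_le {S : C0Semigroup H} (hS : S.IsGeneratedBy T)
    (hT : IsDissipative T) (hd : Dense (T.domain : Set H)) {t : ℝ} (ht : 0 ≤ t) (x : H) :
    ‖S.toFun t x‖ ≤ ‖x‖ := by
  let _ : InnerProductSpace ℝ H := InnerProductSpace.rclikeToReal ℂ H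
  refine hd.induction (P := fun x => ‖S.toFun t x‖ ≤ ‖x‖) (fun x hx => ?_)
    (isClosed_le (by fun_prop) (by fun_prop)) x
  have hxy : (x, T ⟨x, hx⟩) ∈ T.graph := T.mem_graph ⟨x, hx⟩
  refine (sq_le_sq₀ (norm_nonneg _) (norm_nonneg _)).1 <|
    image_le_of_deriv_right_le_deriv_boundary (f := fun s => ‖S.toFun s x‖ ^ 2)
      (f' := fun s => 2 * inner ℝ (S.toFun s x) (S.toFun s (T ⟨x, hx⟩)))
      (((S.continuousOn x).mono Set.Icc_subset_Ici_self).norm.pow 2)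
      (fun s hs => (hS.hasDerivWithinAt hxy hs.1).norm_sq.Ici_of_Ioi)
      (B := fun _ => ‖x‖ ^ 2) (B' := fun _ => 0) (by simp [S.map_zero]) continuousOn_const
      (fun s _ => hasDerivWithinAt_const _ _ _) (fun s hs => ?_) (Set.right_mem_Icc.2 ht)
  exact mul_nonpos_of_nonneg_of_nonpos zero_le_two (hT _ _ (hS.apply_mem_graph hxy hs.1))

namespace IsDissipative

lemma eq_zero_of_mem_graph (hT : IsDissipative T) (hz : 0 < z.re) (hx : (x, z • x) ∈ T.graph) :
    x = 0 := by
  have hle := hT _ _ hx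
  have hsq : (inner ℂ x (z • x)).re = z.re * ‖x‖ ^ 2 := by
    rw [inner_smul_right, inner_self_eq_norm_sq_to_K, ← RCLike.ofReal_pow]
    exact re_mul_ofReal z (‖x‖ ^ 2)
  rw [hsq] at hle
  exact norm_eq_zero.1 (pow_eq_zero_iff two_ne_zero |>.1
    (le_antisymm (nonpos_of_mul_nonpos_right hle hz) (sq_nonneg _)))

lemma resolventApply_eq (hT : IsDissipative T) (hz : 0 < z.re) (hx : (x, z • x - q) ∈ T.graph) :
    resolventApply T z q = x := by
  have hsol : ∃ u : T.domain, z • (u : H) - T u = q := by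
    obtain ⟨u, rfl, hu⟩ := (LinearPMap.mem_graph_iff _).1 hx
    exact ⟨u, by rw [hu, sub_sub_cancel]⟩
  rw [resolventApply, dif_pos hsol]
  refine sub_eq_zero.1 (hT.eq_zero_of_mem_graph hz ?_)
  have hdiff := T.graph.sub_mem (T.mem_graph hsol.choose) hx
  rwa [Prod.mk_sub_mk, ← sub_sub_self (z • (hsol.choose : H)) (T hsol.choose), hsol.choose_spec,
    sub_sub_sub_cancel_right, ← smul_sub] at hdiff

lemma rankOne_vadd (hT : IsDissipative T) (hc : c.re ≤ 0) (p : H) :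
    IsDissipative ((c • InnerProductSpace.rankOne ℂ p p : H →L[ℂ] H).toLinearMap +ᵥ T) := by
  intro x y hxy
  have hTx := hT _ _ (mem_graph_vadd_iff.1 hxy)
  have hrank : (inner ℂ x (c • inner ℂ p x • p)).re = c.re * normSq (inner ℂ p x) := by
    rw [inner_smul_right, inner_smul_right, ← inner_conj_symm x p, mul_conj, re_mul_ofReal]
  rw [inner_sub_right, sub_re, sub_nonpos] at hTx
  exact hTx.trans (hrank.trans_le (mul_nonpos_of_nonpos_of_nonneg hc (normSq_nonneg _)))

lemma one_sub_mul_inner_ne_zero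
    (hT : IsDissipative ((c • InnerProductSpace.rankOne ℂ p p : H →L[ℂ] H).toLinearMap +ᵥ T))
    (hz : 0 < z.re) (hw : (w, z • w - p) ∈ T.graph) : 1 - c * inner ℂ p w ≠ 0 := fun h => by
  have hcw : c * inner ℂ p w = 1 := (sub_eq_zero.1 h).symm
  have hw_zero : w = 0 := hT.eq_zero_of_mem_graph hz <| mem_graph_vadd_iff.2 <| by
    simpa [smul_smul, hcw] using hw
  simp [hw_zero] at hcw

end IsDissipative

lemma exists_mem_graph_rankOne_vadd {u : H} (hu : (u, z • u - q) ∈ T.graph)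
    (hw : (w, z • w - p) ∈ T.graph) (hne : 1 - c * inner ℂ p w ≠ 0) :
    ∃ x, (x, z • x - q) ∈
        ((c • InnerProductSpace.rankOne ℂ p p : H →L[ℂ] H).toLinearMap +ᵥ T).graph ∧
      inner ℂ p x = inner ℂ p u / (1 - c * inner ℂ p w) := by
  set a := inner ℂ p u / (1 - c * inner ℂ p w) with ha
  have hpx : inner ℂ p (u + (c * a) • w) = a := by
    rw [inner_add_right, inner_smul_right, ha]
    field_simp
    ring
  refine ⟨u + (c * a) • w, mem_graph_vadd_iff.2 ?_, hpx⟩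
  convert T.graph.add_mem hu (T.graph.smul_mem (c * a) hw) using 1
  ext1
  · rfl
  · simp only [ContinuousLinearMap.coe_coe, _root_.smul_apply,
      InnerProductSpace.rankOne_apply, hpx, Prod.snd_add, Prod.smul_snd]
    module

end Dissipative

section OrderParameter

variable (g : ProbDensity)

lemma dense_domain_mulOp : Dense ((mulOp g).domain : Set g.L2) := by
  refine Metric.dense_iff.2 fun u r hr => ?_
  obtain ⟨f, hf_supp, hfu, hf_cont, hf⟩ := (Lp.memLp u).exists_hasCompactSupport_eLpNorm_sub_le
    ENNReal.ofNat_ne_top (ε := ENNReal.ofReal (r / 2)) (by simpa using hr)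
  refine ⟨hf.toLp f, ?_, (memLp_congr_ae ?_).2 (Continuous.memLp_of_hasCompactSupport
    (f := fun ω : ℝ => (ω : ℂ) * f ω) (by fun_prop) hf_supp.mul_left)⟩
  · rw [Metric.mem_ball, dist_comm, Lp.dist_def,
      eLpNorm_congr_ae ((ae_eq_refl u).sub hf.coeFn_toLp)]
    refine (ENNReal.toReal_mono ENNReal.ofReal_ne_top hfu).trans_lt ?_
    rw [ENNReal.toReal_ofReal (half_pos hr).le]
    exact half_lt_self hr
  · filter_upwards [hf.coeFn_toLp] with ω hω
    rw [hω]

lemma isDissipative_I_smul_mulOp : IsDissipative (I • mulOp g) := by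
  intro u v huv
  have hv := (mem_graph_I_smul_mulOp_iff g).1 huv
  have hconj : (starRingEnd ℂ) (inner ℂ u v) = -inner ℂ u v := by
    rw [inner_conj_symm, L2.inner_def, L2.inner_def, ← integral_neg]
    refine integral_congr_ae ?_
    filter_upwards [hv] with ω hω
    simp only [hω, RCLike.inner_apply, map_mul, conj_I, conj_ofReal]
    ring
  have hre := congrArg re hconj
  rw [conj_re, neg_re] at hre
  linarith

lemma isDissipative_T1 {K : ℝ} {f₁ : ℂ} (hK : 0 ≤ K) (hf : 0 ≤ f₁.im) :
    IsDissipative (T1 g K f₁) :=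
  (isDissipative_I_smul_mulOp g).rankOne_vadd
    (by simpa using mul_nonneg hK hf : (I * K * f₁).re ≤ 0) (P0 g)

lemma integral_measure (f : ℝ → ℂ) : ∫ ω, f ω ∂g.measure = ∫ ω, f ω * g ω := by
  rw [ProbDensity.measure, integral_withDensity_eq_integral_toReal_smul₀
    g.integrable.aemeasurable.ennreal_ofReal (by simp)]
  simp only [ENNReal.toReal_ofReal (g.nonneg _), real_smul, mul_comm]

lemma inner_P0 (u : g.L2) : inner ℂ (P0 g) u = ∫ ω, u ω * g ω := by
  rw [L2.inner_def, ← integral_measure]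
  refine integral_congr_ae ?_
  filter_upwards [Lp.coeFn_const 2 g.measure (1 : ℂ)] with ω hω
  rw [P0, hω, Function.const_apply, RCLike.inner_apply, map_one, mul_one]

lemma integrable_mul_density {q : ℝ → ℂ} (hq : MemLp q 2 g.measure) :
    Integrable fun ω => q ω * g ω := by
  have := hq.integrable one_le_two
  rw [ProbDensity.measure, integrable_withDensity_iff_integrable_smul₀'
    g.integrable.aemeasurable.ennreal_ofReal (by simp)] at this
  simpa only [ENNReal.toReal_ofReal (g.nonneg _), real_smul, mul_comm] using this

variable {g} {z : ℂ}

lemma abs_re_le_norm_sub_I_mul (z : ℂ) (ω : ℝ) : |z.re| ≤ ‖z - I * ω‖ := by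
  simpa using abs_re_le_norm (z - I * ω)

lemma sub_I_mul_ne_zero (hz : z.re ≠ 0) (ω : ℝ) : z - I * ω ≠ 0 :=
  norm_pos_iff.1 ((abs_pos.2 hz).trans_le (abs_re_le_norm_sub_I_mul z ω))

lemma norm_inv_sub_I_mul_le (hz : z.re ≠ 0) (ω : ℝ) : ‖(z - I * ω)⁻¹‖ ≤ |z.re|⁻¹ := by
  rw [norm_inv]
  exact inv_anti₀ (abs_pos.2 hz) (abs_re_le_norm_sub_I_mul z ω)

lemma memLp_top_inv_sub_I_mul (hz : z.re ≠ 0) (μ : Measure ℝ) :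
    MemLp (fun ω : ℝ => (z - I * ω)⁻¹) ⊤ μ :=
  memLp_top_of_bound (Continuous.inv₀ (by fun_prop) (sub_I_mul_ne_zero hz)).aestronglyMeasurable
    |z.re|⁻¹ (Eventually.of_forall (norm_inv_sub_I_mul_le hz))

lemma exists_mem_graph_I_smul_mulOp {q : ℝ → ℂ} (hq : MemLp q 2 g.measure) (hz : z.re ≠ 0) :
    ∃ u : g.L2, (u, z • u - hq.toLp q) ∈ (I • mulOp g).graph ∧
      inner ℂ (P0 g) u = freePairing g q z := by
  have hu : MemLp (fun ω : ℝ => q ω * (z - I * ω)⁻¹) 2 g.measure :=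
    (memLp_top_inv_sub_I_mul hz _).mul hq
  refine ⟨hu.toLp, (mem_graph_I_smul_mulOp_iff g).2 ?_, ?_⟩
  · filter_upwards [Lp.coeFn_sub (z • hu.toLp) (hq.toLp q), Lp.coeFn_smul z hu.toLp,
      hu.coeFn_toLp, hq.coeFn_toLp] with ω h₁ h₂ h₃ h₄
    simp only [h₁, Pi.sub_apply, h₂, Pi.smul_apply, h₃, h₄, smul_eq_mul]
    linear_combination q ω * mul_inv_cancel₀ (sub_I_mul_ne_zero hz ω)
  · rw [inner_P0, ← integral_measure, integral_congr_ae hu.coeFn_toLp, integral_measure,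
      freePairing]
    exact integral_congr_ae (Eventually.of_forall fun ω => by ring)

lemma exists_mem_graph_P0 (g : ProbDensity) (hz : z.re ≠ 0) :
    ∃ w : g.L2, (w, z • w - P0 g) ∈ (I • mulOp g).graph ∧
      inner ℂ (P0 g) w = stieltjesD g z := by
  obtain ⟨w, hw, hPw⟩ := exists_mem_graph_I_smul_mulOp (memLp_const (μ := g.measure) (1 : ℂ)) hz
  exact ⟨w, hw, by simpa [freePairing, stieltjesD] using hPw⟩

variable {K : ℝ} {f₁ : ℂ} {q : ℝ → ℂ} (hK : 0 ≤ K) (hf : 0 ≤ f₁.im) (hq : MemLp q 2 g.measure)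
include hK hf

lemma one_sub_mul_stieltjesD_ne_zero (g : ProbDensity) (hz : 0 < z.re) :
    1 - I * K * f₁ * stieltjesD g z ≠ 0 := by
  obtain ⟨w, hw, hPw⟩ := exists_mem_graph_P0 g hz.ne'
  exact hPw ▸ (isDissipative_T1 g hK hf).one_sub_mul_inner_ne_zero hz hw

lemma exists_mem_graph_T1 (hz : 0 < z.re) :
    ∃ x : g.L2, (x, z • x - hq.toLp q) ∈ (T1 g K f₁).graph ∧
      inner ℂ (P0 g) x = freePairing g q z / (1 - I * K * f₁ * stieltjesD g z) := by
  obtain ⟨u, hu, hPu⟩ := exists_mem_graph_I_smul_mulOp hq hz.ne'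
  obtain ⟨w, hw, hPw⟩ := exists_mem_graph_P0 g hz.ne'
  have hne := one_sub_mul_stieltjesD_ne_zero hK hf g hz
  rw [← hPw] at hne
  rw [← hPu, ← hPw]
  exact exists_mem_graph_rankOne_vadd hu hw hne

theorem F0_eq (hz : 0 < z.re) :
    F0 g K f₁ (hq.toLp q) z = freePairing g q z / (1 - I * K * f₁ * stieltjesD g z) := by
  obtain ⟨x, hx, hPx⟩ := exists_mem_graph_T1 hK hf hq hz
  rw [F0, (isDissipative_T1 g hK hf).resolventApply_eq hz hx, hPx]

variable {S : C0Semigroup g.L2} (hS : S.IsGeneratedBy (T1 g K f₁))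
include hS

lemma norm_semigroup_apply_le {t : ℝ} (ht : 0 ≤ t) (x : g.L2) : ‖S.toFun t x‖ ≤ ‖x‖ :=
  hS.norm_apply_le (isDissipative_T1 g hK hf) (dense_domain_mulOp g) ht x

theorem laplaceTransform_orderParameter (hz : 0 < z.re) :
    laplaceTransform (fun t => inner ℂ (P0 g) (S.toFun t (hq.toLp q))) z =
      F0 g K f₁ (hq.toLp q) z := by
  obtain ⟨x, hx, -⟩ := exists_mem_graph_T1 hK hf hq hz
  have hcontr := fun t (ht : 0 ≤ t) => norm_semigroup_apply_le hK hf hS ht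
  have hint := integrableOn_exp_neg_mul_smul (n := 0) (S.continuousOn (hq.toLp q))
    (fun t ht => by simpa using hcontr t ht (hq.toLp q)) hz
  rw [F0, (isDissipative_T1 g hK hf).resolventApply_eq hz hx,
    ← hS.laplaceTransform_apply hcontr hz hx]
  refine Eq.trans ?_ (integral_inner hint (P0 g))
  simp only [laplaceTransform, inner_smul_right, smul_eq_mul]

end OrderParameter

section ParametricIntegral

variable {α E : Type*} [MeasurableSpace α] {μ : Measure α} [NormedAddCommGroup E]

lemma aestronglyMeasurable_deriv_of_eventually {𝕜 : Type*} [NontriviallyNormedField 𝕜]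
    [NormedSpace 𝕜 E] {F : 𝕜 → α → E} {w : 𝕜} (hmeas : ∀ᶠ x in 𝓝 w, AEStronglyMeasurable (F x) μ)
    (hdiff : ∀ᵐ a ∂μ, DifferentiableAt 𝕜 (F · a) w) :
    AEStronglyMeasurable (fun a => deriv (F · a) w) μ := by
  obtain ⟨x, hx, hxm⟩ := exists_seq_forall_of_frequently
    (hmeas.filter_mono (nhdsWithin_le_nhds (s := {w}ᶜ))).frequently
  refine aestronglyMeasurable_of_tendsto_ae atTop (f := fun n a => slope (F · a) w (x n))
    (fun n => ?_) (hdiff.mono fun a ha => ha.hasDerivAt.tendsto_slope.comp hx)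
  simp only [slope_def_module]
  exact ((hxm n).sub hmeas.self_of_nhds).const_smul _

variable [NormedSpace ℂ E]

-- Cauchy's estimate turns the bound on the integrand into one on its derivative.
theorem hasDerivAt_integral_of_differentiableOn {F : ℂ → α → E} {U : Set ℂ} (hU : IsOpen U)
    {bound : α → ℝ} (hmeas : ∀ w ∈ U, AEStronglyMeasurable (F w) μ)
    (hdiff : ∀ᵐ a ∂μ, DifferentiableOn ℂ (F · a) U)
    (hb : ∀ᵐ a ∂μ, ∀ w ∈ U, ‖F w a‖ ≤ bound a) (hbi : Integrable bound μ) {w : ℂ} (hw : w ∈ U) :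
    HasDerivAt (fun w => ∫ a, F w a ∂μ) (∫ a, deriv (F · a) w ∂μ) w := by
  have hUw : U ∈ 𝓝 w := hU.mem_nhds hw
  obtain ⟨r, hr, hrU⟩ := Metric.nhds_basis_closedBall.mem_iff.1 hUw
  have hr' : 0 < r / 2 := half_pos hr
  have hsub : ∀ x ∈ Metric.ball w (r / 2), Metric.closedBall x (r / 2) ⊆ U := fun x hx =>
    (Metric.closedBall_subset_closedBall' (by linarith [Metric.mem_ball.1 hx])).trans hrU
  refine (hasDerivAt_integral_of_dominated_loc_of_deriv_le (F' := fun w a => deriv (F · a) w)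
    (bound := fun a => bound a / (r / 2)) (Metric.ball_mem_nhds w hr') ?_
    (hbi.mono' (hmeas w hw) (hb.mono fun a ha => ha w hw)) ?_ ?_ (hbi.div_const _) ?_).2
  · filter_upwards [hUw] with x hx using hmeas x hx
  · exact aestronglyMeasurable_deriv_of_eventually (eventually_of_mem hUw hmeas)
      (hdiff.mono fun a ha => ha.differentiableAt hUw)
  · filter_upwards [hdiff, hb] with a ha hba x hx
    exact norm_deriv_le_of_forall_mem_sphere_norm_le hr'
      (ha.mono (Metric.closure_ball_subset_closedBall.trans (hsub x hx))).diffContOnCl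
      fun y hy => hba y (hsub x hx (Metric.sphere_subset_closedBall hy))
  · filter_upwards [hdiff] with a ha x hx
    exact (ha.differentiableAt
      (hU.mem_nhds (hsub x hx (Metric.mem_closedBall_self hr'.le)))).hasDerivAt

end ParametricIntegral

section CauchyIntegral

/-- The Cauchy integral of `h` along the imaginary axis; `stieltjesD g` and `freePairing g q` are
the cases `h = g` and `h = q g`. -/
def cauchyIntegral (h : ℝ → ℂ) (z : ℂ) : ℂ := ∫ ω : ℝ, h ω / (z - I * ω)

variable {h : ℝ → ℂ} {z : ℂ} {a b : ℝ}

lemma integrable_div_sub_I_mul (hh : Integrable h) (hz : z.re ≠ 0) :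
    Integrable fun ω : ℝ => h ω / (z - I * ω) :=
  hh.mul_of_top_left (memLp_top_inv_sub_I_mul hz volume)

lemma differentiableAt_setIntegral_div_sub_I_mul (hh : Integrable h) {s : Set ℝ}
    (hs : MeasurableSet s) {r : ℝ} (hr : 0 < r) (hsep : ∀ ω ∈ s, r ≤ ‖z - I * ω‖) :
    DifferentiableAt ℂ (fun z => ∫ ω in s, h ω / (z - I * ω)) z := by
  have hr' : 0 < r / 2 := half_pos hr
  have hfar : ∀ ω ∈ s, ∀ w ∈ Metric.ball z (r / 2), r / 2 ≤ ‖w - I * ω‖ := fun ω hω w hw => by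
    have htri := norm_sub_le_norm_sub_add_norm_sub z w (I * ω)
    rw [norm_sub_rev z w] at htri
    linarith [hsep ω hω, mem_ball_iff_norm.1 hw]
  refine (hasDerivAt_integral_of_differentiableOn (F := fun w (ω : ℝ) => h ω / (w - I * ω))
    Metric.isOpen_ball (bound := fun ω => ‖h ω‖ / (r / 2))
    (fun w _ => hh.aestronglyMeasurable.restrict.div₀ (by fun_prop)) ?_ ?_
    (hh.norm.div_const _).restrict (Metric.mem_ball_self hr')).differentiableAt
  · filter_upwards [ae_restrict_mem hs] with ω hω w hw
    have hne : w - I * ω ≠ 0 := norm_pos_iff.1 (hr'.trans_le (hfar ω hω w hw))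
    fun_prop (disch := assumption)
  · filter_upwards [ae_restrict_mem hs] with ω hω w hw
    rw [norm_div]
    exact div_le_div_of_nonneg_left (norm_nonneg _) hr' (hfar ω hω w hw)

lemma differentiableAt_cauchyIntegral (hh : Integrable h) (hz : z.re ≠ 0) :
    DifferentiableAt ℂ (cauchyIntegral h) z := by
  simpa only [cauchyIntegral, Measure.restrict_univ] using!
    differentiableAt_setIntegral_div_sub_I_mul hh MeasurableSet.univ (abs_pos.2 hz) fun ω _ =>
      abs_re_le_norm_sub_I_mul z ω

lemma analyticAt_cauchyIntegral (hh : Integrable h) (hz : z.re ≠ 0) :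
    AnalyticAt ℂ (cauchyIntegral h) z :=
  analyticAt_iff_eventually_differentiableAt.2 <|
    (continuous_re.continuousAt.eventually_ne hz).mono fun _ => differentiableAt_cauchyIntegral hh

lemma differentiableAt_setIntegral_compl_Ioc (hh : Integrable h) (ha : a < z.im) (hb : z.im < b) :
    DifferentiableAt ℂ (fun z => ∫ ω in (Set.Ioc a b)ᶜ, h ω / (z - I * ω)) z := by
  refine differentiableAt_setIntegral_div_sub_I_mul hh measurableSet_Ioc.compl
    (lt_min (sub_pos.2 ha) (sub_pos.2 hb)) fun ω hω => ?_
  have him : |z.im - ω| ≤ ‖z - I * ω‖ := by simpa using abs_im_le_norm (z - I * ω)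
  refine le_trans ?_ him
  rcases le_or_gt ω a with hωa | hωa
  · exact (min_le_left _ _).trans ((by linarith : z.im - a ≤ z.im - ω).trans (le_abs_self _))
  · have hbω : b < ω := not_le.1 fun hωb => hω ⟨hωa, hωb⟩
    exact (min_le_right _ _).trans ((by linarith : b - z.im ≤ -(z.im - ω)).trans (neg_le_abs _))

lemma log_neg_of_im_pos {v : ℂ} (hv : 0 < v.im) : log (-v) = log v - Real.pi * I := by
  apply Complex.ext <;> simp [log_re, log_im, arg_neg_eq_arg_sub_pi_of_im_pos hv]

lemma log_neg_of_im_neg {v : ℂ} (hv : v.im < 0) : log (-v) = log v + Real.pi * I := by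
  apply Complex.ext <;> simp [log_re, log_im, arg_neg_eq_arg_add_pi_of_im_neg hv]

lemma continuous_inv_sub_I_mul (hz : z.re ≠ 0) : Continuous fun ω : ℝ => (z - I * ω)⁻¹ :=
  Continuous.inv₀ (by fun_prop) (sub_I_mul_ne_zero hz)

lemma integral_inv_sub_I_mul_of_re_pos (hz : 0 < z.re) (a b : ℝ) :
    ∫ ω in a..b, (z - I * ω)⁻¹ = I * (log (z - I * b) - log (z - I * a)) := by
  have hderiv (ω : ℝ) : HasDerivAt (fun ω : ℝ => I * log (z - I * ω)) (z - I * ω)⁻¹ ω := by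
    have hlin : HasDerivAt (fun ω : ℝ => z - I * (ω : ℂ)) (-I) ω := by
      simpa using (((hasDerivAt_id (ω : ℂ)).const_mul I).const_sub z).comp_ofReal
    refine ((hlin.clog_real (Or.inl (by simpa using hz))).const_mul I).congr_deriv ?_
    rw [mul_div_assoc', mul_neg, I_mul_I, neg_neg, one_div]
  rw [intervalIntegral.integral_eq_sub_of_hasDerivAt (fun ω _ => hderiv ω)
    ((continuous_inv_sub_I_mul hz.ne').intervalIntegrable _ _), mul_sub]

lemma integral_inv_sub_I_mul_of_re_neg (hz : z.re < 0) (ha : a < z.im) (hb : z.im < b) :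
    ∫ ω in a..b, (z - I * ω)⁻¹ = I * (log (z - I * b) - log (z - I * a)) - 2 * Real.pi := by
  have hreflect : ∫ ω in a..b, (z - I * ω)⁻¹ = -∫ ω in (-b)..(-a), (-z - I * ω)⁻¹ := by
    rw [← intervalIntegral.integral_neg, ← intervalIntegral.integral_comp_neg]
    refine intervalIntegral.integral_congr fun ω _ => ?_
    simp only [ofReal_neg, ← inv_neg]
    ring_nf
  have hneg (c : ℝ) : -z - I * ((-c : ℝ) : ℂ) = -(z - I * c) := by push_cast; ring
  rw [hreflect, integral_inv_sub_I_mul_of_re_pos (by simpa using hz), hneg, hneg,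
    log_neg_of_im_pos (by simpa using ha), log_neg_of_im_neg (by simpa using hb)]
  linear_combination (2 * (Real.pi : ℂ)) * I_sq

end CauchyIntegral

section DividedDifference

variable {f : ℂ → ℂ} {U : Set ℂ} {M : ℝ} {a b : ℝ} {w : ℂ}

lemma norm_dslope_le {𝕜 : Type*} [RCLike 𝕜] {f : 𝕜 → 𝕜} {s : Set 𝕜} (hs : Convex ℝ s)
    (hf : ∀ x ∈ s, DifferentiableAt 𝕜 f x) (hM : ∀ x ∈ s, ‖deriv f x‖ ≤ M) {x y : 𝕜}
    (hx : x ∈ s) (hy : y ∈ s) : ‖dslope f x y‖ ≤ M := by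
  rcases eq_or_ne y x with rfl | hne
  · exact (dslope_same f y).symm ▸ hM y hy
  · rw [dslope_of_ne _ hne, slope_def_field, norm_div,
      div_le_iff₀ (norm_pos_iff.2 (sub_ne_zero.2 hne))]
    exact hs.norm_image_sub_le_of_norm_deriv_le hf hM hx hy

lemma ae_ne_ofReal (w : ℂ) : ∀ᵐ ω : ℝ, w ≠ ω :=
  (Measure.ae_ne volume w.re).mono fun ω hω h => hω (by rw [h, ofReal_re])

lemma aestronglyMeasurable_dslope (hf : ∀ ω ∈ Set.Ioc a b, ContinuousAt f (ω : ℂ)) (w : ℂ) :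
    AEStronglyMeasurable (fun ω : ℝ => dslope f ω w) (volume.restrict (Set.Ioc a b)) := by
  have hcont : ContinuousOn (fun ω : ℝ => f ω) (Set.Ioc a b) := fun ω hω =>
    ((hf ω hω).comp continuous_ofReal.continuousAt).continuousWithinAt
  refine AEStronglyMeasurable.congr (f := fun ω : ℝ => (f w - f ω) / (w - ω))
    ((aestronglyMeasurable_const.sub (hcont.aestronglyMeasurable measurableSet_Ioc)).div₀
      (by fun_prop)) ?_
  filter_upwards [ae_restrict_of_ae (ae_ne_ofReal w)] with ω hω
  rw [dslope_of_ne _ hω, slope_def_field]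

variable (hU : IsOpen U) (hUc : Convex ℝ U) (hf : DifferentiableOn ℂ f U)
  (hM : ∀ x ∈ U, ‖deriv f x‖ ≤ M) (hab : ∀ ω ∈ Set.Ioc a b, (ω : ℂ) ∈ U) (hw : w ∈ U)
include hU hUc hf hM hab hw

lemma integrableOn_dslope : IntegrableOn (fun ω : ℝ => dslope f ω w) (Set.Ioc a b) := by
  have hfU : ∀ x ∈ U, DifferentiableAt ℂ f x := fun x hx => hf.differentiableAt (hU.mem_nhds hx)
  refine (integrable_const M).mono'
    (aestronglyMeasurable_dslope (fun ω hω => (hfU _ (hab ω hω)).continuousAt) w) ?_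
  filter_upwards [ae_restrict_mem measurableSet_Ioc] with ω hω
  exact norm_dslope_le hUc hfU hM (hab ω hω) hw

lemma differentiableAt_setIntegral_dslope :
    DifferentiableAt ℂ (fun w => ∫ ω : ℝ in Set.Ioc a b, dslope f ω w) w := by
  have hfU : ∀ x ∈ U, DifferentiableAt ℂ f x := fun x hx => hf.differentiableAt (hU.mem_nhds hx)
  refine (hasDerivAt_integral_of_differentiableOn (F := fun w (ω : ℝ) => dslope f ω w) hU
    (bound := fun _ => M) (fun w _ => aestronglyMeasurable_dslope
      (fun ω hω => (hfU _ (hab ω hω)).continuousAt) w) ?_ ?_ (integrable_const M)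
    hw).differentiableAt
  · filter_upwards [ae_restrict_mem measurableSet_Ioc] with ω hω
    exact (Complex.differentiableOn_dslope (hU.mem_nhds (hab ω hω))).2 hf
  · filter_upwards [ae_restrict_mem measurableSet_Ioc] with ω hω w hw
    exact norm_dslope_le hUc hfU hM (hab ω hω) hw

end DividedDifference

section Continuation

lemma eventually_neg_I_mul_mem {U : Set ℂ} {y : ℝ} (hU : U ∈ 𝓝 (y : ℂ)) :
    ∀ᶠ z in 𝓝 (I * (y : ℂ)), -I * z ∈ U := by
  refine (by fun_prop : Continuous fun z : ℂ => -I * z).continuousAt.eventually_mem ?_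
  rwa [show -I * (I * y) = (y : ℂ) by linear_combination (-y : ℂ) * I_sq]

/-- The part of the Cauchy integral of `h` that continues analytically across the segment
`I * [a, b]`: the singular kernel only acts on the divided difference of the continuation `hs`
of `h`. -/
def regularPart (h : ℝ → ℂ) (hs : ℂ → ℂ) (a b : ℝ) (z : ℂ) : ℂ :=
  (∫ ω in (Set.Ioc a b)ᶜ, h ω / (z - I * ω)) + I * ∫ ω : ℝ in Set.Ioc a b, dslope hs ω (-I * z)

variable {h : ℝ → ℂ} {hs : ℂ → ℂ} {U : Set ℂ} {M : ℝ} {a b : ℝ} {z : ℂ} (hh : Integrable h)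
include hh

section

variable (hU : IsOpen U) (hUc : Convex ℝ U) (hd : DifferentiableOn ℂ hs U)
  (hM : ∀ x ∈ U, ‖deriv hs x‖ ≤ M) (hJ : ∀ ω ∈ Set.Ioc a b, (ω : ℂ) ∈ U) (hz : -I * z ∈ U)
include hU hUc hd hM hJ hz

lemma differentiableAt_regularPart (ha : a < z.im) (hb : z.im < b) :
    DifferentiableAt ℂ (regularPart h hs a b) z :=
  (differentiableAt_setIntegral_compl_Ioc hh ha hb).add <| DifferentiableAt.const_mul
    ((differentiableAt_setIntegral_dslope hU hUc hd hM hJ hz).fun_comp' z (by fun_prop)) _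

lemma cauchyIntegral_eq_regularPart_add (heq : ∀ x : ℝ, hs x = h x) (hab : a ≤ b)
    (hz₀ : z.re ≠ 0) :
    cauchyIntegral h z =
      regularPart h hs a b z + hs (-I * z) * ∫ ω in a..b, (z - I * ω)⁻¹ := by
  have hsplit (ω : ℝ) :
      h ω / (z - I * ω) = I * dslope hs ω (-I * z) + hs (-I * z) * (z - I * ω)⁻¹ := by
    have hne : -I * z ≠ ω := fun he => hz₀ (by simpa using congrArg Complex.im he)
    have hker := sub_I_mul_ne_zero hz₀ ω
    rw [dslope_of_ne _ hne, slope_def_field, heq,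
      show -I * z - ω = -I * (z - I * ω) by linear_combination (-ω : ℂ) * I_sq]
    field_simp
    ring
  rw [cauchyIntegral, ← integral_add_compl measurableSet_Ioc (integrable_div_sub_I_mul hh hz₀),
    setIntegral_congr_fun measurableSet_Ioc fun ω _ => hsplit ω, integral_add
      ((integrableOn_dslope hU hUc hd hM hJ hz).const_mul I)
      ((continuous_inv_sub_I_mul hz₀).const_mul _).integrableOn_Ioc,
    integral_const_mul, integral_const_mul, intervalIntegral.integral_of_le hab, regularPart]
  ring

end

/-- `Φ` continues the Cauchy integral of `h` analytically from the right half plane across the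
point `I * y`; to the left it picks up the residue term of the continuation `hs` of `h`. -/
structure IsCauchyContinuationAt (h : ℝ → ℂ) (hs : ℂ → ℂ) (y : ℝ) (Φ : ℂ → ℂ) : Prop where
  analyticAt : AnalyticAt ℂ Φ (I * y)
  eq_of_re_pos : ∀ᶠ z in 𝓝 (I * (y : ℂ)), 0 < z.re → Φ z = cauchyIntegral h z
  eq_of_re_neg : ∀ᶠ z in 𝓝 (I * (y : ℂ)), z.re < 0 →
    Φ z = cauchyIntegral h z + 2 * Real.pi * hs (-I * z)

theorem exists_isCauchyContinuationAt (heq : ∀ x : ℝ, hs x = h x) {y : ℝ}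
    (hy : AnalyticAt ℂ hs y) : ∃ Φ, IsCauchyContinuationAt h hs y Φ := by
  have hM : ∀ᶠ x in 𝓝 (y : ℂ), ‖deriv hs x‖ < ‖deriv hs y‖ + 1 :=
    hy.deriv.continuousAt.norm.eventually_lt continuousAt_const (lt_add_one _)
  obtain ⟨r, hr, hball⟩ := Metric.eventually_nhds_iff_ball.1 (hy.eventually_analyticAt.and hM)
  have hd : DifferentiableOn ℂ hs (Metric.ball y r) := fun x hx =>
    (hball x hx).1.differentiableAt.differentiableWithinAt
  obtain ⟨a, ha⟩ : ∃ a, a = y - r / 2 := ⟨_, rfl⟩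
  obtain ⟨b, hb⟩ : ∃ b, b = y + r / 2 := ⟨_, rfl⟩
  have hJ : ∀ ω ∈ Set.Ioc a b, (ω : ℂ) ∈ Metric.ball (y : ℂ) r := fun ω hω => by
    rw [mem_ball_iff_norm, ← ofReal_sub, norm_real, Real.norm_eq_abs, abs_lt]
    constructor <;> linarith [hω.1, hω.2]
  have hnear : ∀ᶠ z in 𝓝 (I * (y : ℂ)), -I * z ∈ Metric.ball (y : ℂ) r ∧ a < z.im ∧ z.im < b := by
    refine (eventually_neg_I_mul_mem (Metric.ball_mem_nhds _ hr)).and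
      ((continuous_im.continuousAt.eventually_const_lt ?_).and
      (continuous_im.continuousAt.eventually_lt_const ?_))
    · simp only [mul_im, I_re, I_im, ofReal_im, ofReal_re]; linarith
    · simp only [mul_im, I_re, I_im, ofReal_im, ofReal_re]; linarith
  have hregular {z : ℂ} (hz : -I * z ∈ Metric.ball (y : ℂ) r) (hz₀ : z.re ≠ 0) :=
    cauchyIntegral_eq_regularPart_add hh Metric.isOpen_ball (convex_ball _ _) hd
      (fun x hx => (hball x hx).2.le) hJ hz heq (by linarith : a ≤ b) hz₀
  refine ⟨fun z => regularPart h hs a b z +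
    hs (-I * z) * (I * (log (z - I * b) - log (z - I * a))), ?_, ?_, ?_⟩
  · refine analyticAt_iff_eventually_differentiableAt.2 (hnear.mono fun z ⟨hz, hza, hzb⟩ => ?_)
    refine (differentiableAt_regularPart hh Metric.isOpen_ball (convex_ball _ _) hd
      (fun x hx => (hball x hx).2.le) hJ hz hza hzb).add <|
      ((hball _ hz).1.differentiableAt.fun_comp' z (by fun_prop)).mul <|
      .const_mul (.sub (.clog (by fun_prop) (.inr ?_)) (.clog (by fun_prop) (.inr ?_))) _
    · simpa using (sub_neg.2 hzb).ne
    · simpa using (sub_pos.2 hza).ne'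
  · filter_upwards [hnear] with z ⟨hz, _⟩ hz₀
    rw [hregular hz hz₀.ne', integral_inv_sub_I_mul_of_re_pos hz₀]
  · filter_upwards [hnear] with z ⟨hz, hza, hzb⟩ hz₀
    rw [hregular hz hz₀.ne, integral_inv_sub_I_mul_of_re_neg hz₀ hza hzb]
    ring

end Continuation

section BoundaryValues

variable {h : ℝ → ℂ} {hs Φ : ℂ → ℂ} {y : ℝ}

lemma tendsto_I_mul_add (y : ℝ) :
    Tendsto (fun ε : ℝ => I * (y : ℂ) + ε) (𝓝[>] 0) (𝓝 (I * y)) := by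
  have hcont : Continuous fun ε : ℝ => I * (y : ℂ) + ε := by fun_prop
  simpa using hcont.tendsto' 0 _ (by simp) |>.mono_left nhdsWithin_le_nhds

lemma tendsto_I_mul_sub (y : ℝ) :
    Tendsto (fun ε : ℝ => I * (y : ℂ) - ε) (𝓝[>] 0) (𝓝 (I * y)) := by
  have hcont : Continuous fun ε : ℝ => I * (y : ℂ) - ε := by fun_prop
  simpa using hcont.tendsto' 0 _ (by simp) |>.mono_left nhdsWithin_le_nhds

lemma stieltjesD_neg_conj (g : ProbDensity) (z : ℂ) :
    stieltjesD g (-starRingEnd ℂ z) = -starRingEnd ℂ (stieltjesD g z) := by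
  rw [stieltjesD, stieltjesD, ← integral_conj, ← integral_neg]
  refine integral_congr_ae (Eventually.of_forall fun ω => ?_)
  simp only [map_div₀, map_sub, map_mul, conj_I, conj_ofReal, ← div_neg]
  ring

-- `D(iy + ε) + D(iy - ε)` is purely imaginary by reflection, so only the residue term survives.
lemma IsCauchyContinuationAt.re_apply_I_mul {g : ProbDensity}
    (hΦ : IsCauchyContinuationAt (fun ω => (g ω : ℂ)) hs y Φ) (hs_cont : ContinuousAt hs y)
    (hs_eq : hs y = g y) : (Φ (I * y)).re = Real.pi * g y := by
  have hright := tendsto_I_mul_add y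
  have hleft := tendsto_I_mul_sub y
  have hres : Tendsto (fun ε : ℝ => hs (-I * (I * y - ε))) (𝓝[>] 0) (𝓝 (g y)) := by
    refine hs_eq ▸ hs_cont.tendsto.comp ?_
    have := hleft.const_mul (-I)
    rwa [show -I * (I * y) = (y : ℂ) by linear_combination (-y : ℂ) * I_sq] at this
  have hlim : Tendsto
      (fun ε : ℝ => (Φ (I * y + ε) + Φ (I * y - ε) - 2 * Real.pi * hs (-I * (I * y - ε))).re)
      (𝓝[>] 0) (𝓝 (Φ (I * y) + Φ (I * y) - 2 * Real.pi * g y).re) :=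
    (continuous_re.tendsto _).comp (((hΦ.analyticAt.continuousAt.tendsto.comp hright).add
      (hΦ.analyticAt.continuousAt.tendsto.comp hleft)).sub (hres.const_mul _))
  have hzero : (Φ (I * y) + Φ (I * y) - 2 * Real.pi * g y).re = 0 := by
    refine tendsto_nhds_unique hlim (tendsto_const_nhds.congr' ?_)
    filter_upwards [hright.eventually hΦ.eq_of_re_pos, hleft.eventually hΦ.eq_of_re_neg,
      self_mem_nhdsWithin] with ε hpos hneg (hε : 0 < ε)
    have hreflect := stieltjesD_neg_conj g (I * y + ε)
    rw [show -starRingEnd ℂ (I * y + ε) = I * y - ε by simp; ring] at hreflect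
    rw [hpos (by simpa using hε), hneg (by simpa using hε)]
    change 0 = (stieltjesD g _ + (stieltjesD g _ + _) - _).re
    rw [hreflect, ← add_assoc, add_sub_cancel_right, add_re, neg_re, conj_re, add_neg_cancel]
  rw [show Φ (I * y) + Φ (I * y) - 2 * Real.pi * g y =
    Φ (I * y) + Φ (I * y) - ((2 * Real.pi * g y : ℝ) : ℂ) by push_cast; ring, sub_re, add_re,
    ofReal_re] at hzero
  linarith

lemma abs_sub_le_norm_add_sub (y ε ω : ℝ) : |y - ω| ≤ ‖I * y + ε - I * ω‖ := by
  simpa using abs_im_le_norm (I * y + ε - I * ω)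

lemma norm_I_mul_sub_I_mul (y ω : ℝ) : ‖I * (y : ℂ) - I * ω‖ = |y - ω| := by
  rw [← mul_sub, norm_mul, norm_I, one_mul, ← ofReal_sub, norm_real, Real.norm_eq_abs]

lemma integrable_div_I_mul_sub (hh : Integrable h) (hO : h =O[𝓝 y] fun ω => ω - y) :
    Integrable fun ω : ℝ => h ω / (I * y - I * ω) := by
  obtain ⟨C, hC⟩ := hO.bound
  obtain ⟨r, hr, hball⟩ := Metric.eventually_nhds_iff_ball.1 hC
  have hmeas : AEStronglyMeasurable (fun ω : ℝ => h ω / (I * y - I * ω)) volume :=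
    hh.aestronglyMeasurable.div₀ (by fun_prop)
  have hnear : IntegrableOn (fun ω : ℝ => h ω / (I * y - I * ω)) (Metric.ball y r) := by
    refine Measure.integrableOn_of_bounded (M := |C|) measure_ball_lt_top.ne hmeas ?_
    filter_upwards [ae_restrict_mem measurableSet_ball] with ω hω
    rw [norm_div, norm_I_mul_sub_I_mul, abs_sub_comm]
    exact div_le_of_le_mul₀ (abs_nonneg _) (abs_nonneg _)
      ((hball ω hω).trans (mul_le_mul_of_nonneg_right (le_abs_self C) (norm_nonneg _)))
  have hfar : IntegrableOn (fun ω : ℝ => h ω / (I * y - I * ω)) (Metric.ball y r)ᶜ := by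
    refine (hh.norm.div_const r).restrict.mono' hmeas.restrict ?_
    filter_upwards [ae_restrict_mem measurableSet_ball.compl] with ω hω
    rw [norm_div, norm_I_mul_sub_I_mul, abs_sub_comm]
    exact div_le_div_of_nonneg_left (norm_nonneg _) hr (by simpa [Real.dist_eq] using hω)
  simpa only [Set.union_compl_self, integrableOn_univ] using hnear.union hfar

lemma tendsto_cauchyIntegral_I_mul (hh : Integrable h) (hO : h =O[𝓝 y] fun ω => ω - y) :
    Tendsto (fun ε : ℝ => cauchyIntegral h (I * y + ε)) (𝓝[>] 0)
      (𝓝 (cauchyIntegral h (I * y))) := by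
  refine tendsto_integral_filter_of_dominated_convergence _
    (Eventually.of_forall fun ε => hh.aestronglyMeasurable.div₀ (by fun_prop))
    (Eventually.of_forall fun ε => ?_) (integrable_div_I_mul_sub hh hO).norm ?_
  · filter_upwards [Measure.ae_ne volume y] with ω hω
    rw [norm_div, norm_div, norm_I_mul_sub_I_mul]
    exact div_le_div_of_nonneg_left (norm_nonneg _) (abs_pos.2 (sub_ne_zero.2 hω.symm))
      (abs_sub_le_norm_add_sub y ε ω)
  · filter_upwards [Measure.ae_ne volume y] with ω hω
    refine tendsto_const_nhds.div ((tendsto_I_mul_add y).sub_const _) ?_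
    rw [← norm_pos_iff, norm_I_mul_sub_I_mul]
    exact abs_pos.2 (sub_ne_zero.2 hω.symm)

lemma IsCauchyContinuationAt.apply_I_mul_of_isBigO (hΦ : IsCauchyContinuationAt h hs y Φ)
    (hh : Integrable h) (hO : h =O[𝓝 y] fun ω => ω - y) :
    Φ (I * y) = cauchyIntegral h (I * y) := by
  have hright := tendsto_I_mul_add y
  refine tendsto_nhds_unique ((hΦ.analyticAt.continuousAt.tendsto.comp hright).congr' ?_)
    (tendsto_cauchyIntegral_I_mul hh hO)
  filter_upwards [hright.eventually hΦ.eq_of_re_pos, self_mem_nhdsWithin] with ε heq hε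
  exact heq (by simpa using hε)

lemma stieltjesD_I_mul (g : ProbDensity) (y : ℝ) :
    stieltjesD g (I * y) = -I * ((∫ ω : ℝ, g ω / (y - ω) : ℝ) : ℂ) := by
  rw [stieltjesD, ← integral_complex_ofReal, ← integral_const_mul]
  refine integral_congr_ae (Eventually.of_forall fun ω => ?_)
  simp only [ofReal_div, ofReal_sub]
  rw [← mul_sub, div_mul_eq_div_div_swap, div_I]
  ring

lemma isBigO_sub_of_differentiableAt (hs_diff : DifferentiableAt ℂ hs y)
    (hs_eq : ∀ x : ℝ, hs x = h x) (hy : h y = 0) : h =O[𝓝 y] fun ω => ω - y := by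
  have hO := hs_diff.isBigO_sub.comp_tendsto (continuous_ofReal.tendsto y)
  simp only [Function.comp_def, hs_eq, hy, sub_zero, ← ofReal_sub] at hO
  exact hO.trans (Asymptotics.isBigO_of_le _ fun ω => (norm_real _).le)

lemma re_eq_zero_of_mul_eq_one {c w : ℂ} (hcw : c * w = 1) (hc : c.re ≤ 0) (hw : 0 ≤ w.re) :
    c.re = 0 ∧ w.re = 0 := by
  have hconj : w.re = c.re * normSq w := by
    rw [← re_mul_ofReal, ← mul_conj, ← mul_assoc, hcw, one_mul, conj_re]
  have hw₀ : 0 < normSq w := normSq_pos.2 (right_ne_zero_of_mul_eq_one hcw)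
  have hc₀ : c.re = 0 := hc.antisymm (nonneg_of_mul_nonneg_left (hconj ▸ hw) hw₀)
  exact ⟨hc₀, by rw [hconj, hc₀, zero_mul]⟩

-- A zero would be an eigenvalue of `T₁` at `I * y`: comparing real parts in `c Φ = 1` with
-- `Re c ≤ 0 ≤ Re Φ` forces `f₁` to be real and `g y = 0`, which is the excluded case.
lemma one_sub_mul_continuation_ne_zero {g : ProbDensity} {K : ℝ} {f₁ : ℂ} (hK : 0 ≤ K)
    (hf : 0 ≤ f₁.im) (hres : f₁.im = 0 → g y = 0 → K * f₁.re * ∫ ω : ℝ, g ω / (y - ω) ≠ 1)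
    (hs_an : AnalyticAt ℂ hs y) (hs_eq : ∀ x : ℝ, hs x = g x)
    (hΦ : IsCauchyContinuationAt (fun ω => (g ω : ℂ)) hs y Φ) :
    1 - I * K * f₁ * Φ (I * y) ≠ 0 := by
  intro hzero
  have hmul : I * K * f₁ * Φ (I * y) = 1 := (sub_eq_zero.1 hzero).symm
  have hΦre := hΦ.re_apply_I_mul hs_an.continuousAt (hs_eq y)
  obtain ⟨hc, hw⟩ := re_eq_zero_of_mul_eq_one hmul (by simpa using mul_nonneg hK hf)
    (hΦre ▸ mul_nonneg Real.pi_pos.le (g.nonneg y))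
  have hK₀ : K ≠ 0 := by rintro rfl; simp at hmul
  have hfim : f₁.im = 0 := by simpa [hK₀] using hc
  have hgy : g y = 0 := (mul_eq_zero.1 (hΦre ▸ hw)).resolve_left Real.pi_ne_zero
  refine hres hfim hgy ?_
  rw [hΦ.apply_I_mul_of_isBigO g.integrable.ofReal
    (isBigO_sub_of_differentiableAt hs_an.differentiableAt hs_eq (by simp [hgy]))] at hmul
  change I * K * f₁ * stieltjesD g (I * y) = 1 at hmul
  rw [stieltjesD_I_mul, (Complex.ext rfl hfim : f₁ = (f₁.re : ℂ))] at hmul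
  have hreal : ((K * f₁.re * ∫ ω : ℝ, g ω / (y - ω) : ℝ) : ℂ) = 1 := by
    push_cast
    linear_combination hmul + (K * f₁.re * ((∫ ω : ℝ, g ω / (y - ω) : ℝ) : ℂ)) * I_sq
  exact_mod_cast hreal

end BoundaryValues

section F1

variable {g : ProbDensity} {K : ℝ} {f₁ : ℂ} {q : ℝ → ℂ} {gs qs : ℂ → ℂ} {z : ℂ}

lemma IsAnalyticContinuation.isMeromorphicContinuation {φ : ℝ → ℂ} {φs : ℂ → ℂ}
    (h : IsAnalyticContinuation φ φs) : IsMeromorphicContinuation φ φs :=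
  ⟨h.eq_real, h.analyticAt_real, h.analyticOnNhd.meromorphicOn⟩

lemma F1pre_of_re_pos (hq : MemLp q 2 g.measure) (hz : 0 < z.re) :
    F1pre g K f₁ q hq gs qs z = F0 g K f₁ (hq.toLp q) z := if_pos hz

lemma F1pre_of_re_neg (hq : MemLp q 2 g.measure) (hz : z.re < 0) :
    F1pre g K f₁ q hq gs qs z =
      (freePairing g q z + 2 * Real.pi * qs (-I * z) * gs (-I * z)) /
        (1 - I * K * f₁ * stieltjesD g z - 2 * Real.pi * I * K * f₁ * gs (-I * z)) := by
  rw [F1pre, if_neg hz.not_gt, if_pos hz]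

lemma limUnder_re_pos_eq {F Ψ : ℂ → ℂ} (hz : z.re = 0) (hΨ : ContinuousAt Ψ z)
    (heq : ∀ᶠ w in 𝓝 z, 0 < w.re → F w = Ψ w) :
    limUnder (𝓝[{w : ℂ | 0 < w.re}] z) F = Ψ z := by
  have : (𝓝[{w : ℂ | 0 < w.re}] z).NeBot := by
    rw [← mem_closure_iff_nhdsWithin_neBot, closure_setOfPred_lt_re]
    exact hz.ge
  refine Tendsto.limUnder_eq ((hΨ.tendsto.mono_left nhdsWithin_le_nhds).congr' ?_)
  filter_upwards [nhdsWithin_le_nhds heq, self_mem_nhdsWithin] with w hw hw₀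
  exact (hw hw₀).symm

lemma analyticAt_F1pre_of_re_pos (hK : 0 ≤ K) (hf : 0 ≤ f₁.im) (hq : MemLp q 2 g.measure)
    (hz : 0 < z.re) : AnalyticAt ℂ (F1pre g K f₁ q hq gs qs) z := by
  have hquot : AnalyticAt ℂ (fun w => cauchyIntegral (fun ω => q ω * g ω) w /
      (1 - I * K * f₁ * cauchyIntegral (fun ω => (g ω : ℂ)) w)) z :=
    (analyticAt_cauchyIntegral (integrable_mul_density g hq) hz.ne').div
      (analyticAt_const.sub (analyticAt_const.mul
        (analyticAt_cauchyIntegral g.integrable.ofReal hz.ne')))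
      (one_sub_mul_stieltjesD_ne_zero hK hf g hz)
  refine hquot.congr ?_
  filter_upwards [continuous_re.continuousAt.eventually_const_lt hz] with w hw
  rw [F1pre_of_re_pos hq hw, F0_eq hK hf hq hw]
  rfl

variable (hgs : IsMeromorphicContinuation (fun ω => (g ω : ℂ)) gs)
  (hqs : IsMeromorphicContinuation q qs)
include hgs hqs

lemma analyticAt_F1pre_I_mul (hK : 0 ≤ K) (hf : 0 ≤ f₁.im) (hq : MemLp q 2 g.measure) {y : ℝ}
    (hres : f₁.im = 0 → g y = 0 → K * f₁.re * ∫ ω : ℝ, g ω / (y - ω) ≠ 1) :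
    AnalyticAt ℂ (F1pre g K f₁ q hq gs qs) (I * y) := by
  obtain ⟨Φ, hΦ⟩ := exists_isCauchyContinuationAt g.integrable.ofReal hgs.eq_real
    (hgs.analyticAt_real y)
  obtain ⟨Θ, hΘ⟩ := exists_isCauchyContinuationAt (integrable_mul_density g hq)
    (hs := fun z => qs z * gs z) (fun x => by rw [hqs.eq_real, hgs.eq_real])
    ((hqs.analyticAt_real y).mul (hgs.analyticAt_real y))
  have hΨ : AnalyticAt ℂ (fun z => Θ z / (1 - I * K * f₁ * Φ z)) (I * y) :=
    hΘ.analyticAt.div (analyticAt_const.sub (analyticAt_const.mul hΦ.analyticAt))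
      (one_sub_mul_continuation_ne_zero hK hf hres (hgs.analyticAt_real y) hgs.eq_real hΦ)
  have hright : ∀ᶠ z in 𝓝 (I * (y : ℂ)), 0 < z.re →
      F0 g K f₁ (hq.toLp q) z = Θ z / (1 - I * K * f₁ * Φ z) := by
    filter_upwards [hΦ.eq_of_re_pos, hΘ.eq_of_re_pos] with z hΦz hΘz hz
    rw [F0_eq hK hf hq hz, hΦz hz, hΘz hz]
    rfl
  refine hΨ.congr ?_
  filter_upwards [hΦ.eq_of_re_neg, hΘ.eq_of_re_neg, hright, hright.eventually_nhds,
    hΨ.eventually_analyticAt] with z hΦz hΘz hrz hr_near hΨz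
  rcases lt_trichotomy z.re 0 with hz | hz | hz
  · rw [F1pre_of_re_neg hq hz, hΦz hz, hΘz hz]
    change (freePairing g q z + _) / (1 - _ * (stieltjesD g z + _)) = _
    congr 1 <;> ring
  · rw [F1pre, if_neg hz.not_gt, if_neg hz.not_lt,
      limUnder_re_pos_eq hz hΨz.continuousAt hr_near]
  · rw [F1pre_of_re_pos hq hz, hrz hz]

lemma meromorphicAt_F1pre_of_re_neg (hq : MemLp q 2 g.measure) (hz : z.re < 0) :
    MeromorphicAt (F1pre g K f₁ q hq gs qs) z := by
  have hQ : MeromorphicAt (freePairing g q) z :=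
    (analyticAt_cauchyIntegral (integrable_mul_density g hq) hz.ne).meromorphicAt
  have hD : MeromorphicAt (stieltjesD g) z :=
    (analyticAt_cauchyIntegral g.integrable.ofReal hz.ne).meromorphicAt
  have him : 0 < (-I * z).im := by simpa using hz
  have hrot : AnalyticAt ℂ (fun z : ℂ => -I * z) z := analyticAt_const.mul analyticAt_id
  have hgs' : MeromorphicAt (fun z => gs (-I * z)) z :=
    (hgs.meromorphicOn _ him).comp_analyticAt hrot
  have hqs' : MeromorphicAt (fun z => qs (-I * z)) z :=
    (hqs.meromorphicOn _ him).comp_analyticAt hrot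
  have hformula : MeromorphicAt (fun z =>
      (freePairing g q z + 2 * Real.pi * qs (-I * z) * gs (-I * z)) /
      (1 - I * K * f₁ * stieltjesD g z - 2 * Real.pi * I * K * f₁ * gs (-I * z))) z :=
    (hQ.add (((MeromorphicAt.const _ z).mul hqs').mul hgs')).div
      (((MeromorphicAt.const _ z).sub ((MeromorphicAt.const _ z).mul hD)).sub
        ((MeromorphicAt.const _ z).mul hgs'))
  refine hformula.congr ?_
  filter_upwards [nhdsWithin_le_nhds (continuous_re.continuousAt.eventually_lt_const hz)] with w hw
  exact (F1pre_of_re_neg hq hw).symm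

variable (hK : 0 ≤ K) (hf : 0 ≤ f₁.im) (hq : MemLp q 2 g.measure)
  (hres : f₁.im = 0 → ∀ y : ℝ, g y = 0 → K * f₁.re * ∫ ω : ℝ, g ω / (y - ω) ≠ 1)
include hK hf hq hres

lemma analyticAt_F1pre (hz : 0 ≤ z.re) : AnalyticAt ℂ (F1pre g K f₁ q hq gs qs) z := by
  rcases hz.lt_or_eq with hz | hz
  · exact analyticAt_F1pre_of_re_pos hK hf hq hz
  · have hzy : z = I * (z.im : ℂ) := by
      apply Complex.ext <;> simp [← hz]
    rw [hzy]
    exact analyticAt_F1pre_I_mul hgs hqs hK hf hq fun hfim => hres hfim z.im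

lemma meromorphicOn_F1pre : MeromorphicOn (F1pre g K f₁ q hq gs qs) Set.univ := fun z _ =>
  (lt_or_ge z.re 0).elim (meromorphicAt_F1pre_of_re_neg hgs hqs hq) fun hz =>
    (analyticAt_F1pre hgs hqs hK hf hq hres hz).meromorphicAt

theorem F1_eq_F0 (hz : 0 < z.re) :
    F1 g K f₁ q hq gs qs z = F0 g K f₁ (hq.toLp q) z := by
  rw [F1, toMeromorphicNFOn_eq_toMeromorphicNFAt
      (meromorphicOn_F1pre hgs hqs hK hf hq hres) (Set.mem_univ z),
    toMeromorphicNFAt_eq_self.2 (analyticAt_F1pre hgs hqs hK hf hq hres hz.le).meromorphicNFAt,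
    F1pre_of_re_pos hq hz]

theorem analyticAt_F1 (hz : 0 ≤ z.re) : AnalyticAt ℂ (F1 g K f₁ q hq gs qs) z := by
  have hNF : MeromorphicNFAt (F1 g K f₁ q hq gs qs) z :=
    meromorphicNFOn_toMeromorphicNFOn _ _ (Set.mem_univ z)
  refine hNF.meromorphicOrderAt_nonneg_iff_analyticAt.1 ?_
  rw [F1, meromorphicOrderAt_toMeromorphicNFOn (meromorphicOn_F1pre hgs hqs hK hf hq hres)
    (Set.mem_univ z)]
  exact (analyticAt_F1pre hgs hqs hK hf hq hres hz).meromorphicOrderAt_nonneg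

end F1

section StripBound

lemma abs_arg_le_of_abs_im_le {w : ℂ} {d : ℝ} (hd0 : 0 ≤ d) (hd : d < Real.pi / 2) (hw : 0 < w.re)
    (h : |w.im| ≤ Real.sin d * w.re) : |arg w| ≤ d := by
  have hpos : 0 < ‖w‖ := hw.trans_le (re_le_norm w)
  have hsin : |w.im / ‖w‖| ≤ Real.sin d := by
    rw [abs_div, abs_norm, div_le_iff₀ hpos]
    exact h.trans (mul_le_mul_of_nonneg_left (re_le_norm w)
      (Real.sin_nonneg_of_nonneg_of_le_pi hd0 (by linarith [Real.pi_pos])))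
  rw [arg_of_re_nonneg hw.le, abs_le]
  rw [abs_le, ← Real.sin_neg] at hsin
  exact ⟨Real.le_arcsin_iff_sin_le' ⟨by linarith, by linarith [Real.pi_pos]⟩ |>.2 hsin.1,
    Real.arcsin_le_iff_le_sin' ⟨by linarith [Real.pi_pos], by linarith⟩ |>.2 hsin.2⟩

lemma exists_cone_subset_verticalSectors {δ : ℝ} (hδ : 0 < δ) :
    ∃ κ : ℝ, 0 < κ ∧ κ ≤ 1 ∧ ∀ z : ℂ, z.im ≠ 0 → |z.re| ≤ κ * |z.im| → z ∈ verticalSectors δ := by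
  set d := min δ 1
  have hd0 : 0 < d := lt_min hδ one_pos
  have hd1 : d < Real.pi / 2 := (min_le_right _ _).trans_lt (by linarith [Real.pi_gt_three])
  refine ⟨Real.sin d, Real.sin_pos_of_pos_of_lt_pi hd0 (by linarith [Real.pi_gt_three]),
    Real.sin_le_one d, fun z hz h => ?_⟩
  have harg (w : ℂ) (hw : 0 < w.re) (h : |w.im| ≤ Real.sin d * w.re) : |arg w| ≤ δ :=
    (abs_arg_le_of_abs_im_le hd0.le hd1 hw h).trans (min_le_left _ _)
  rcases lt_or_gt_of_ne hz with hz | hz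
  · rw [abs_of_neg hz] at h
    exact Or.inr (harg _ (by simpa using hz) (by simpa using h))
  · rw [abs_of_pos hz] at h
    exact Or.inl (harg _ (by simpa using hz) (by simpa using h))

lemma abs_re_le_mul_abs_im_of_mem_ball {κ : ℝ} (hκ0 : 0 ≤ κ) (hκ1 : κ ≤ 1) {z w : ℂ}
    (hre : |z.re| ≤ 1) (him : 4 ≤ κ * |z.im|) (hw : w ∈ Metric.ball z (κ / 4 * |z.im|)) :
    |z.im| ≤ 2 * |w.im| ∧ |w.re| ≤ κ * |w.im| := by
  have hdist := mem_ball_iff_norm.1 hw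
  have hwre : |w.re| - |z.re| < κ / 4 * |z.im| :=
    (abs_sub_abs_le_abs_sub _ _).trans_lt ((abs_re_le_norm (w - z)).trans_lt hdist)
  have hwim : |z.im| - |w.im| < κ / 4 * |z.im| :=
    (abs_sub_abs_le_abs_sub _ _).trans_lt <| by
      rw [abs_sub_comm]
      exact (abs_im_le_norm (w - z)).trans_lt hdist
  have hκz : κ * |z.im| ≤ |z.im| := mul_le_of_le_one_left (abs_nonneg _) hκ1
  have hκw : κ * (3 / 4 * |z.im|) ≤ κ * |w.im| :=
    mul_le_mul_of_nonneg_left (by linarith) hκ0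
  exact ⟨by linarith, by linarith⟩

lemma exists_forall_mem_ball_norm_le {F : ℂ → ℂ} {δ : ℝ} (hδ : 0 < δ)
    (hF : F =O[Bornology.cobounded ℂ ⊓ 𝓟 (verticalSectors δ)] (1 : ℂ → ℝ)) :
    ∃ ρ M Y : ℝ, 0 < ρ ∧ 0 < Y ∧ ∀ z : ℂ, |z.re| ≤ 1 → Y ≤ |z.im| →
      ∀ w ∈ Metric.ball z (ρ * |z.im|), ‖F w‖ ≤ M := by
  obtain ⟨κ, hκ0, hκ1, hκ⟩ := exists_cone_subset_verticalSectors hδ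
  obtain ⟨M, hM⟩ := hF.bound
  rw [eventually_inf_principal] at hM
  obtain ⟨R, -, hR⟩ := hasBasis_cobounded_norm.eventually_iff.1 hM
  refine ⟨κ / 4, M, max (2 * R) (4 / κ), by positivity, lt_max_of_lt_right (by positivity),
    fun z hre him w hw => ?_⟩
  have h4 : 4 ≤ κ * |z.im| := (div_le_iff₀' hκ0).1 ((le_max_right _ _).trans him)
  obtain ⟨hwim, hwre⟩ := abs_re_le_mul_abs_im_of_mem_ball hκ0.le hκ1 hre h4 hw
  have hRw : R ≤ |w.im| := by linarith [(le_max_left _ _).trans him]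
  have hw0 : w.im ≠ 0 := abs_pos.1 (by
    linarith [pos_of_mul_pos_right (four_pos.trans_le h4) hκ0.le])
  simpa using hR (hRw.trans (abs_im_le_norm w)) (hκ w hw0 hwre)

lemma analyticAt_of_eventually_norm_le {F : ℂ → ℂ} {z : ℂ} (hF : MeromorphicNFAt F z) {M : ℝ}
    (hM : ∀ᶠ w in 𝓝 z, ‖F w‖ ≤ M) : AnalyticAt ℂ F z := by
  rw [← hF.meromorphicOrderAt_nonneg_iff_analyticAt]
  by_contra! hneg
  have hlim := (tendsto_cobounded_iff_meromorphicOrderAt_neg hF.meromorphicAt).2 hneg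
  rw [← tendsto_norm_atTop_iff_cobounded] at hlim
  obtain ⟨w, hlt, hle⟩ := ((hlim.eventually_gt_atTop M).and (nhdsWithin_le_nhds hM)).exists
  exact hlt.not_ge hle

lemma exists_pos_forall_neg_le_re_analyticAt {F : ℂ → ℂ}
    (hF : ∀ z : ℂ, 0 ≤ z.re → AnalyticAt ℂ F z) {Y : ℝ}
    (hfar : ∀ z : ℂ, |z.re| ≤ 1 → Y ≤ |z.im| → AnalyticAt ℂ F z) :
    ∃ γ : ℝ, 0 < γ ∧ γ ≤ 1 ∧ ∀ z : ℂ, -γ ≤ z.re → AnalyticAt ℂ F z := by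
  have hcpt : IsCompact ((fun y : ℝ => I * (y : ℂ)) '' Set.Icc (-Y) Y) :=
    isCompact_Icc.image (by fun_prop)
  obtain ⟨ε, hε, hsub⟩ := hcpt.exists_cthickening_subset_open (isOpen_analyticAt ℂ F) (by
    rintro _ ⟨y, -, rfl⟩
    exact hF _ (by simp))
  refine ⟨min ε 1, lt_min hε one_pos, min_le_right _ _, fun z hz => ?_⟩
  rcases le_total 0 z.re with hre | hre
  · exact hF z hre
  have habs : |z.re| ≤ min ε 1 := by
    rw [abs_of_nonpos hre]
    linarith
  rcases le_total Y |z.im| with him | him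
  · exact hfar z (habs.trans (min_le_right _ _)) him
  refine hsub (Metric.mem_cthickening_of_dist_le z (I * (z.im : ℂ)) ε _
    ⟨z.im, abs_le.1 him, rfl⟩ ?_)
  have hsub_eq : z - I * (z.im : ℂ) = (z.re : ℂ) := by apply Complex.ext <;> simp
  rw [dist_eq_norm, hsub_eq, norm_real]
  exact habs.trans (min_le_left _ _)

lemma norm_deriv_deriv_le_of_forall_mem_ball {F : ℂ → ℂ} {z : ℂ} {r M : ℝ} (hr : 0 < r)
    (hF : DifferentiableOn ℂ F (Metric.ball z r)) (hM : ∀ w ∈ Metric.ball z r, ‖F w‖ ≤ M) :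
    ‖deriv (deriv F) z‖ ≤ 8 * M / r ^ 2 := by
  have hsub : Metric.closedBall z (r / 2) ⊆ Metric.ball z r :=
    Metric.closedBall_subset_ball (by linarith)
  have hcauchy := norm_iteratedDeriv_le_of_forall_mem_sphere_norm_le (f := F) (C := M) 2
    (half_pos hr)
    ((hF.mono (Metric.closure_ball_subset_closedBall.trans hsub)).diffContOnCl)
    (fun w hw => hM w (hsub (Metric.sphere_subset_closedBall hw)))
  rw [iteratedDeriv_succ, iteratedDeriv_one] at hcauchy
  refine hcauchy.trans_eq ?_
  rw [Nat.factorial_two, Nat.cast_two]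
  ring

lemma exists_strip_bound {F : ℂ → ℂ} (hNF : MeromorphicNFOn F Set.univ)
    (han : ∀ z : ℂ, 0 ≤ z.re → AnalyticAt ℂ F z) {δ : ℝ} (hδ : 0 < δ)
    (hF : F =O[Bornology.cobounded ℂ ⊓ 𝓟 (verticalSectors δ)] (1 : ℂ → ℝ)) :
    ∃ γ C : ℝ, 0 < γ ∧ (∀ z : ℂ, -γ ≤ z.re → AnalyticAt ℂ F z) ∧
      ∀ z : ℂ, -γ ≤ z.re → z.re ≤ 1 → ‖deriv (deriv F) z‖ ≤ C / (1 + z.im ^ 2) := by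
  obtain ⟨ρ, M, Y, hρ, hY, hM⟩ := exists_forall_mem_ball_norm_le hδ hF
  have hfar (z : ℂ) (hre : |z.re| ≤ 1) (him : Y ≤ |z.im|) (w : ℂ)
      (hw : w ∈ Metric.ball z (ρ * |z.im|)) : AnalyticAt ℂ F w :=
    analyticAt_of_eventually_norm_le (hNF (Set.mem_univ w))
      (eventually_of_mem (Metric.isOpen_ball.mem_nhds hw) (hM z hre him))
  have hr (z : ℂ) (him : Y ≤ |z.im|) : 0 < ρ * |z.im| := mul_pos hρ (hY.trans_le him)
  obtain ⟨γ, hγ0, hγ1, hγ⟩ := exists_pos_forall_neg_le_re_analyticAt han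
    fun z hre him => hfar z hre him z (Metric.mem_ball_self (hr z him))
  have hcont : ContinuousOn (fun z => deriv (deriv F) z * (1 + (z.im : ℂ) ^ 2))
      (Set.Icc (-γ) 1 ×ℂ Set.Icc (-Y) Y) := fun z hz =>
    ((hγ z hz.1.1).deriv.deriv.continuousAt.mul (by fun_prop)).continuousWithinAt
  obtain ⟨B, hB⟩ := (isCompact_Icc.reProdIm isCompact_Icc).exists_bound_of_continuousOn hcont
  have hnorm (z : ℂ) : ‖(1 + (z.im : ℂ) ^ 2)‖ = 1 + z.im ^ 2 := by
    rw [← ofReal_pow, ← ofReal_one, ← ofReal_add, norm_real, Real.norm_of_nonneg (by positivity)]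
  refine ⟨γ, max B (8 * M / ρ ^ 2 * (1 / Y ^ 2 + 1)), hγ0, hγ, fun z hz0 hz1 => ?_⟩
  rw [le_div_iff₀ (by positivity)]
  rcases le_total |z.im| Y with him | him
  · refine le_max_of_le_left ?_
    simpa only [norm_mul, hnorm] using hB z ⟨⟨hz0, hz1⟩, abs_le.1 him⟩
  have hre : |z.re| ≤ 1 := abs_le.2 ⟨by linarith, hz1⟩
  have hM0 : 0 ≤ M := (norm_nonneg _).trans (hM z hre him z (Metric.mem_ball_self (hr z him)))
  have hz : z.im ≠ 0 := abs_pos.1 (hY.trans_le him)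
  refine le_max_of_le_right ?_
  calc ‖deriv (deriv F) z‖ * (1 + z.im ^ 2)
      ≤ 8 * M / (ρ * |z.im|) ^ 2 * (1 + z.im ^ 2) := by
        gcongr
        exact norm_deriv_deriv_le_of_forall_mem_ball (hr z him)
          (fun w hw => (hfar z hre him w hw).differentiableAt.differentiableWithinAt) (hM z hre him)
    _ = 8 * M / ρ ^ 2 * (1 / |z.im| ^ 2 + 1) := by
        rw [← sq_abs z.im]
        have := abs_ne_zero.2 hz
        field_simp
    _ ≤ 8 * M / ρ ^ 2 * (1 / Y ^ 2 + 1) := by gcongr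

end StripBound

section LaplaceInversion

variable {E : Type*} [NormedAddCommGroup E] [NormedSpace ℂ E] {f : ℝ → E} {B : ℝ}

lemma hasDerivAt_laplaceTransform (hf : ContinuousOn f (Set.Ici 0)) {n : ℕ}
    (hb : ∀ t, 0 ≤ t → ‖f t‖ ≤ B * t ^ n) {z : ℂ} (hz : 0 < z.re) :
    HasDerivAt (laplaceTransform f) (laplaceTransform (fun t => (-t : ℂ) • f t) z) z := by
  have hderiv (t : ℝ) (w : ℂ) : HasDerivAt (fun w : ℂ => exp (-(w * t)) • f t)
      (exp (-(w * t)) • (-t : ℂ) • f t) w :=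
    ((hasDerivAt_mul_const (t : ℂ)).fun_neg.cexp.smul_const (f t)).congr_deriv (mul_smul _ _ _)
  have hint := hasDerivAt_integral_of_differentiableOn (μ := volume.restrict (Set.Ioi (0 : ℝ)))
    (F := fun w (t : ℝ) => exp (-(w * t)) • f t) (U := {w : ℂ | z.re / 2 < w.re})
    (bound := fun t => B * (t ^ n * Real.exp (-(z.re / 2) * t)))
    (isOpen_lt continuous_const continuous_re)
    (fun w _ => aestronglyMeasurable_exp_neg_mul_smul hf w)
    (Eventually.of_forall fun t w _ => (hderiv t w).differentiableAt.differentiableWithinAt) ?_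
    ((integrableOn_pow_mul_exp_neg n (half_pos hz)).const_mul B) (half_lt_self hz)
  · simp only [(hderiv _ _).deriv] at hint
    exact hint
  · filter_upwards [ae_restrict_mem measurableSet_Ioi] with t (ht : 0 < t) w (hw : z.re / 2 < w.re)
    rw [norm_exp_neg_mul_smul, ← mul_assoc, mul_comm]
    gcongr
    · exact (norm_nonneg _).trans (hb t ht.le)
    · exact hb t ht.le

lemma deriv_deriv_laplaceTransform (hf : ContinuousOn f (Set.Ici 0)) {n : ℕ}
    (hb : ∀ t, 0 ≤ t → ‖f t‖ ≤ B * t ^ n) {z : ℂ} (hz : 0 < z.re) :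
    deriv (deriv (laplaceTransform f)) z = laplaceTransform (fun t => (t ^ 2 : ℂ) • f t) z := by
  have hfst : deriv (laplaceTransform f) =ᶠ[𝓝 z] laplaceTransform (fun t => (-t : ℂ) • f t) := by
    filter_upwards [(isOpen_lt continuous_const continuous_re).mem_nhds hz] with w hw
    exact (hasDerivAt_laplaceTransform hf hb hw).deriv
  have hb' (t : ℝ) (ht : 0 ≤ t) : ‖(-t : ℂ) • f t‖ ≤ B * t ^ (n + 1) := by
    rw [norm_smul, norm_neg, norm_real, Real.norm_of_nonneg ht, pow_succ', mul_left_comm]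
    exact mul_le_mul_of_nonneg_left (hb t ht) ht
  rw [hfst.deriv_eq, (hasDerivAt_laplaceTransform
    ((Continuous.continuousOn (by fun_prop)).fun_smul hf) hb' hz).deriv]
  simp only [smul_smul, neg_mul_neg, sq]

open FourierTransform

lemma fourier_indicator_exp_neg_mul_smul (f : ℝ → E) (σ ξ : ℝ) :
    𝓕 ((Set.Ioi 0).indicator fun t : ℝ => exp (-(σ * t)) • f t) ξ =
      laplaceTransform f (σ + (2 * Real.pi * ξ : ℝ) * I) := by
  rw [Real.fourier_real_eq_integral_exp_smul, laplaceTransform,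
    ← integral_indicator measurableSet_Ioi]
  refine integral_congr_ae (Eventually.of_forall fun t => ?_)
  simp only [Set.indicator_apply, smul_ite, smul_zero, smul_smul, ← Complex.exp_add]
  push_cast
  ring_nf

theorem eq_integral_exp_smul_laplaceTransform [CompleteSpace E] {σ : ℝ}
    (hf : IntegrableOn (fun t : ℝ => exp (-(σ * t)) • f t) (Set.Ioi 0))
    (hL : Integrable fun y : ℝ => laplaceTransform f (σ + y * I)) {t : ℝ} (ht : 0 < t)
    (hft : ContinuousAt f t) :
    f t = (2 * Real.pi)⁻¹ • ∫ y : ℝ, exp ((σ + y * I) * t) • laplaceTransform f (σ + y * I) := by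
  have hcont : ContinuousAt ((Set.Ioi 0).indicator fun t : ℝ => exp (-(σ * t)) • f t) t :=
    ContinuousAt.congr (Continuous.continuousAt (by fun_prop) |>.smul hft)
      (eventually_of_mem (Ioi_mem_nhds ht) fun s hs => (Set.indicator_of_mem hs _).symm)
  have hfourier := funext (fourier_indicator_exp_neg_mul_smul f σ)
  have hinv := (hf.integrable_indicator measurableSet_Ioi).fourierInv_fourier_eq
    (hfourier ▸ hL.comp_mul_left' (by positivity : 2 * Real.pi ≠ 0)) hcont
  rw [Real.fourierInv_eq', Set.indicator_of_mem (Set.mem_Ioi.2 ht), hfourier] at hinv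
  calc f t = exp (σ * t) • exp (-(σ * t)) • f t := by
        rw [smul_smul, ← Complex.exp_add, add_neg_cancel, Complex.exp_zero, one_smul]
    _ = ∫ ξ : ℝ, exp ((σ + (2 * Real.pi * ξ : ℝ) * I) * t) •
          laplaceTransform f (σ + (2 * Real.pi * ξ : ℝ) * I) := by
        rw [← hinv, ← integral_smul]
        refine integral_congr_ae (Eventually.of_forall fun ξ => ?_)
        simp only [smul_smul, ← Complex.exp_add, RCLike.inner_apply, conj_trivial]
        push_cast
        ring_nf
    _ = _ := by
        rw [Measure.integral_comp_mul_left fun y : ℝ => exp ((σ + y * I) * t) •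
          laplaceTransform f (σ + y * I), abs_of_pos (by positivity)]

end LaplaceInversion

section ContourShift

variable {E : Type*} [NormedAddCommGroup E] {G : ℂ → E} {a b C : ℝ}

lemma integrable_vertical_line (hG : ∀ z : ℂ, z.re = a → ContinuousAt G z)
    (hC : ∀ z : ℂ, z.re = a → ‖G z‖ ≤ C / (1 + z.im ^ 2)) :
    Integrable fun y : ℝ => G (a + y * I) := by
  refine (integrable_inv_one_add_sq.const_mul C).mono' (Continuous.aestronglyMeasurable <|
    continuous_iff_continuousAt.2 fun y => ContinuousAt.comp (f := fun y : ℝ => (a : ℂ) + y * I)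
      (hG _ (by simp)) (by fun_prop)) (Eventually.of_forall fun y => ?_)
  simpa [div_eq_mul_inv] using hC (a + y * I) (by simp)

variable [NormedSpace ℂ E]

lemma norm_integral_vertical_line_le (hC : ∀ z : ℂ, z.re = a → ‖G z‖ ≤ C / (1 + z.im ^ 2)) :
    ‖∫ y : ℝ, G (a + y * I)‖ ≤ C * Real.pi := by
  rw [← integral_univ_inv_one_add_sq, ← integral_const_mul]
  refine norm_integral_le_of_norm_le (integrable_inv_one_add_sq.const_mul C)
    (Eventually.of_forall fun y => ?_)
  simpa [div_eq_mul_inv] using hC (a + y * I) (by simp)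

lemma tendsto_integral_horizontal_segment (hab : a ≤ b)
    (hC : ∀ z : ℂ, a ≤ z.re → z.re ≤ b → ‖G z‖ ≤ C / (1 + z.im ^ 2)) :
    Tendsto (fun y : ℝ => ∫ x in a..b, G (x + y * I)) (Bornology.cobounded ℝ) (𝓝 0) := by
  refine squeeze_zero_norm (a := fun y : ℝ => C / (1 + y ^ 2) * |b - a|) (fun y => ?_) ?_
  · refine intervalIntegral.norm_integral_le_of_norm_le_const fun x hx => ?_
    rw [Set.uIoc_of_le hab] at hx
    simpa using hC (x + y * I) (by simpa using hx.1.le) (by simpa using hx.2)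
  · have hsq : Tendsto (fun y : ℝ => 1 + y ^ 2) (Bornology.cobounded ℝ) atTop := by
      refine tendsto_atTop_add_const_left _ 1 (((tendsto_pow_atTop two_ne_zero).comp
        (tendsto_norm_cobounded_atTop (E := ℝ))).congr fun y => ?_)
      rw [Function.comp_apply, Real.norm_eq_abs, sq_abs]
    simpa using (hsq.const_div_atTop C).mul_const |b - a|

theorem integral_vertical_line_eq (hab : a ≤ b)
    (hG : ∀ z : ℂ, a ≤ z.re → z.re ≤ b → DifferentiableAt ℂ G z)
    (hC : ∀ z : ℂ, a ≤ z.re → z.re ≤ b → ‖G z‖ ≤ C / (1 + z.im ^ 2)) :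
    ∫ y : ℝ, G (a + y * I) = ∫ y : ℝ, G (b + y * I) := by
  have hvert (x : ℝ) (hax : a ≤ x) (hxb : x ≤ b) :
      Tendsto (fun T : ℝ => ∫ y in -T..T, G (x + y * I)) atTop (𝓝 (∫ y : ℝ, G (x + y * I))) :=
    intervalIntegral_tendsto_integral
      (integrable_vertical_line (fun z hz => (hG z (hz ▸ hax) (hz ▸ hxb)).continuousAt)
        fun z hz => hC z (hz ▸ hax) (hz ▸ hxb)) tendsto_neg_atTop_atBot tendsto_id
  have hrect (T : ℝ) : I • ((∫ y in -T..T, G (b + y * I)) - ∫ y in -T..T, G (a + y * I)) =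
      (∫ x in a..b, G (x + T * I)) - ∫ x in a..b, G (x + (-T : ℝ) * I) := by
    have hzero := integral_boundary_rect_eq_zero_of_differentiableOn G ⟨a, -T⟩ ⟨b, T⟩
      fun z hz => by
        rw [Set.uIcc_of_le hab] at hz
        exact (hG z hz.1.1 hz.1.2).differentiableWithinAt
    rw [smul_sub, ← sub_eq_zero, ← hzero]
    abel
  have hhor : Tendsto (fun T : ℝ => (∫ x in a..b, G (x + T * I)) -
      ∫ x in a..b, G (x + (-T : ℝ) * I)) atTop (𝓝 0) := by
    have hseg := tendsto_integral_horizontal_segment hab hC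
    simpa only [sub_zero, Function.comp_def, id_eq] using
      (hseg.comp (tendsto_id.mono_right IsOrderBornology.atTop_le_cobounded)).sub
      (hseg.comp (tendsto_neg_atTop_atBot.mono_right IsOrderBornology.atBot_le_cobounded))
  have hlim := tendsto_nhds_unique (((hvert b hab le_rfl).sub (hvert a le_rfl hab)).const_smul I)
    (hhor.congr fun T => (hrect T).symm)
  exact (sub_eq_zero.1 ((smul_eq_zero.1 hlim).resolve_left I_ne_zero)).symm

end ContourShift

section ExponentialDecay

theorem norm_le_mul_exp_of_laplaceTransform_eqOn {E : Type*} [NormedAddCommGroup E]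
    [NormedSpace ℂ E] [CompleteSpace E] {f : ℝ → E} {G : ℂ → E} {a b C : ℝ} (hab : a ≤ b)
    (hf : IntegrableOn (fun t : ℝ => exp (-(b * t)) • f t) (Set.Ioi 0))
    (hL : ∀ y : ℝ, laplaceTransform f (b + y * I) = G (b + y * I))
    (hG : ∀ z : ℂ, a ≤ z.re → z.re ≤ b → DifferentiableAt ℂ G z)
    (hC : ∀ z : ℂ, a ≤ z.re → z.re ≤ b → ‖G z‖ ≤ C / (1 + z.im ^ 2)) {t : ℝ} (ht : 0 < t)
    (hft : ContinuousAt f t) :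
    ‖f t‖ ≤ C / 2 * Real.exp (a * t) := by
  have hnorm (z : ℂ) (haz : a ≤ z.re) (hzb : z.re ≤ b) :
      ‖exp (z * t) • G z‖ ≤ Real.exp (z.re * t) * C / (1 + z.im ^ 2) := by
    rw [norm_smul, Complex.norm_exp, re_mul_ofReal, mul_div_assoc]
    gcongr
    exact hC z haz hzb
  have hC0 : 0 ≤ C := by simpa using (norm_nonneg _).trans (hC a (by simp) (by simpa using hab))
  have hline := integrable_vertical_line (fun z hz => (hG z (hz ▸ hab) hz.le).continuousAt)
    fun z hz => hC z (hz ▸ hab) hz.le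
  have hshift := integral_vertical_line_eq (G := fun z => exp (z * t) • G z) hab
    (fun z haz hzb => DifferentiableAt.smul (by fun_prop) (hG z haz hzb))
    (C := Real.exp (b * t) * C) fun z haz hzb => (hnorm z haz hzb).trans (by gcongr)
  have hbound := norm_integral_vertical_line_le (G := fun z => exp (z * t) • G z)
    (a := a) (C := Real.exp (a * t) * C) fun z hz => by
      simpa only [hz] using hnorm z hz.ge (hz ▸ hab)
  rw [eq_integral_exp_smul_laplaceTransform hf (by simpa only [hL] using hline) ht hft]
  simp only [hL]
  rw [← hshift, norm_smul, Real.norm_of_nonneg (by positivity)]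
  calc (2 * Real.pi)⁻¹ * ‖∫ y : ℝ, exp ((a + y * I) * t) • G (a + y * I)‖
      ≤ (2 * Real.pi)⁻¹ * (Real.exp (a * t) * C * Real.pi) := by gcongr
    _ = C / 2 * Real.exp (a * t) := by field_simp

theorem decaysExponentially_of_laplaceTransform_eqOn {Z : ℝ → ℂ} {F : ℂ → ℂ} {B C γ : ℝ}
    (hγ : 0 < γ) (hZ : ContinuousOn Z (Set.Ici 0)) (hB : ∀ t, 0 ≤ t → ‖Z t‖ ≤ B)
    (hL : ∀ z : ℂ, 0 < z.re → laplaceTransform Z z = F z)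
    (hF : ∀ z : ℂ, -γ ≤ z.re → AnalyticAt ℂ F z)
    (hC : ∀ z : ℂ, -γ ≤ z.re → z.re ≤ 1 → ‖deriv (deriv F) z‖ ≤ C / (1 + z.im ^ 2)) :
    DecaysExponentially Z := by
  have hL2 (z : ℂ) (hz : 0 < z.re) :
      laplaceTransform (fun t => (t ^ 2 : ℂ) • Z t) z = deriv (deriv F) z := by
    rw [← deriv_deriv_laplaceTransform (n := 0) hZ (by simpa using hB) hz]
    exact EventuallyEq.deriv_eq <| EventuallyEq.deriv <|
      eventually_of_mem ((isOpen_lt continuous_const continuous_re).mem_nhds hz) hL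
  have hint : IntegrableOn (fun t : ℝ => exp (-((1 : ℝ) * t)) • (t ^ 2 : ℂ) • Z t) (Set.Ioi 0) :=
    integrableOn_exp_neg_mul_smul (n := 2) ((Continuous.continuousOn (by fun_prop)).fun_smul hZ)
      (fun t ht => by
        rw [norm_smul, norm_pow, norm_real, Real.norm_of_nonneg ht, mul_comm]
        gcongr
        exact hB t ht) (by simp)
  have hlarge (t : ℝ) (ht : 1 ≤ t) : ‖Z t‖ ≤ C / 2 * Real.exp (-γ * t) := by
    have ht0 : 0 < t := one_pos.trans_le ht
    refine le_trans ?_ (norm_le_mul_exp_of_laplaceTransform_eqOn (by linarith) hint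
      (fun y => hL2 _ (by simp)) (fun z hz _ => (hF z hz).deriv.deriv.differentiableAt) hC ht0
      ((Continuous.continuousAt (by fun_prop)).fun_smul (hZ.continuousAt (Ici_mem_nhds ht0))))
    rw [norm_smul, norm_pow, norm_real, Real.norm_of_nonneg ht0.le]
    exact le_mul_of_one_le_left (norm_nonneg _) (one_le_pow₀ ht)
  refine ⟨max (B * Real.exp γ) (C / 2), γ, hγ, fun t ht => ?_⟩
  rcases le_total 1 t with h1 | h1
  · exact (hlarge t h1).trans (by gcongr; exact le_max_right _ _)
  · have hB0 : 0 ≤ B := (norm_nonneg _).trans (hB t ht)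
    calc ‖Z t‖ ≤ B * 1 := by simpa using hB t ht
      _ ≤ B * Real.exp (γ + -γ * t) := by
        gcongr
        exact Real.one_le_exp (by nlinarith)
      _ = B * Real.exp γ * Real.exp (-γ * t) := by rw [Real.exp_add, mul_assoc]
      _ ≤ _ := by
        gcongr
        exact le_max_left _ _

end ExponentialDecay

end KuramotoDaido

end

open KuramotoDaido in
theorem theorem3p12_general (g : ProbDensity) (gs : ℂ → ℂ) (q : ℝ → ℂ) (qs : ℂ → ℂ) (f₁ : ℂ) (K : ℝ)
    (hK : 0 ≤ K) (hf : 0 ≤ f₁.im)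
    (hres : f₁.im = 0 → ∀ y : ℝ, g y = 0 → K * f₁.re * ∫ ω : ℝ, g ω / (y - ω) ≠ 1)
    (hgs : IsMeromorphicContinuation (fun ω => (g ω : ℂ)) gs)
    (hq : MemLp q 2 g.measure)
    (hqs : IsMeromorphicContinuation q qs)
    {δ : ℝ} (hδ : 0 < δ)
    (hF : F1 g K f₁ q hq gs qs =O[Bornology.cobounded ℂ ⊓ 𝓟 (verticalSectors δ)] (1 : ℂ → ℝ)) :
    (∃ S : C0Semigroup g.L2, S.IsGeneratedBy (T1 g K f₁)) ∧
    ∀ S : C0Semigroup g.L2, S.IsGeneratedBy (T1 g K f₁) →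
      DecaysExponentially (fun t => inner ℂ (P0 g) (S.toFun t (hq.toLp q))) := by
  refine ⟨exists_isGeneratedBy_T1 g K f₁, fun S hS => ?_⟩
  obtain ⟨γ, C, hγ, hana, hC⟩ := exists_strip_bound (meromorphicNFOn_toMeromorphicNFOn _ _)
    (fun z hz => analyticAt_F1 hgs hqs hK hf hq hres hz) hδ hF
  have hlaplace (z : ℂ) (hz : 0 < z.re) :
      laplaceTransform (fun t => inner ℂ (P0 g) (S.toFun t (hq.toLp q))) z =
        F1 g K f₁ q hq gs qs z := by
    rw [laplaceTransform_orderParameter hK hf hq hS hz, F1_eq_F0 hgs hqs hK hf hq hres hz]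
  have hbound (t : ℝ) (ht : 0 ≤ t) :
      ‖inner ℂ (P0 g) (S.toFun t (hq.toLp q))‖ ≤ ‖P0 g‖ * ‖hq.toLp q‖ :=
    (norm_inner_le_norm _ _).trans (mul_le_mul_of_nonneg_left
      (norm_semigroup_apply_le hK hf hS ht _) (norm_nonneg _))
  exact decaysExponentially_of_laplaceTransform_eqOn hγ
    (continuousOn_const.inner (S.continuousOn _)) hbound hlaplace hana hC

open KuramotoDaido in
theorem theorem3p12 (g : ProbDensity) (gs : ℂ → ℂ) (q : ℝ → ℂ) (qs : ℂ → ℂ) (f₁ : ℂ) (K : ℝ)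
    (hK : 0 < K) (hf : 0 ≤ f₁.im)
    (hres : f₁.im = 0 → ∀ y : ℝ, g y = 0 → K * f₁.re * ∫ ω : ℝ, g ω / (y - ω) ≠ 1)
    (hg : AnalyticOnNhd ℝ g Set.univ)
    (hgs : IsMeromorphicContinuation (fun ω => (g ω : ℂ)) gs)
    (hq : MemLp q 2 g.measure)
    (hqa : AnalyticOnNhd ℝ q Set.univ)
    (hqs : IsAnalyticContinuation q qs)
    (hF : GrowthCondition (F1 g K f₁ q hq gs qs)) :
    (∃ S : C0Semigroup g.L2, S.IsGeneratedBy (T1 g K f₁)) ∧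
    ∀ S : C0Semigroup g.L2, S.IsGeneratedBy (T1 g K f₁) →
      DecaysExponentially (fun t => inner ℂ (P0 g) (S.toFun t (hq.toLp q))) := by
  obtain ⟨δ, hδ, hlim, -⟩ := hF
  exact theorem3p12_general g gs q qs f₁ K hK.le hf hres hgs hq hqs.isMeromorphicContinuation hδ
    (hlim.isBigO_one ℝ)
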